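/- Let $\varpi\subset\mathbb C$ be a nonempty connected open set with Lipschitz boundary (near each boundary point, in suitable rotated coordinates, $\varpi$ is the region above the graph of a Lipschitz function). Assume that $\varpi\subset\,]0,1[\,\times\,]-M,M[$ for some $M>0$ and that, for some real $\alpha<\beta$, the boundary $\partial\varpi$ meets the line $\operatorname{Re}z=0$ exactly in $\{0\}\times[\alpha,\beta]$ and the line $\operatorname{Re}z=1$ exactly in $\{1\}\times[\alpha,\beta]$. Let $\Pi$ be the interior of $\bigcup_{m\in\mathbb Z}\operatorname{cl}(\varpi+m)$. For an open set $\Omega\subset\mathbb C$ let $A^2(\Omega)$ be the Bergman space, that is, the closed subspace of the holomorphic functions in $L^2(\Omega)$ (with respect to area measure), and let $P_\Omega$ be the orthogonal projection of $L^2(\Omega)$ onto $A^2(\Omega)$. For $\eta\in[-\pi,\pi]$ let $A^2_{\eta,\mathrm{ext}}(\varpi)$ be the space of all $f\in A^2(\varpi)$ that extend holomorphically to a neighbourhood in $\Pi$ of $\operatorname{cl}(\varpi)\cap\Pi$ and satisfy $f(1+iy)=e^{i\eta}f(iy)$ for all $\alpha<y<\beta$. Let $A^2_\eta(\varpi)$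 be the closure of $A^2_{\eta,\mathrm{ext}}(\varpi)$ in $A^2(\varpi)$, and let $P_\eta$ be the orthogonal projection of $L^2(\varpi)$ onto $A^2_\eta(\varpi)$. Let $a\in L^\infty(\Pi)$ be complex valued with $a(z)=a(z+1)$ for almost every $z\in\Pi$. Define the bounded operators $$T_a:A^2(\Pi)\to A^2(\Pi),\quad T_af=P_\Pi(af),\qquad T_{a,\eta}:A^2_\eta(\varpi)\to A^2_\eta(\varpi),\quad T_{a,\eta}f=P_\eta(a|_\varpi f).$$ Let $\sigma$ denote the spectrum and $\sigma_{\mathrm{ess}}$ the essential spectrum, that is, $\sigma_{\mathrm{ess}}(T)$ is the set of $\lambda\in\mathbb C$ such that $T-\lambda I$ is not a Fredholm operator. Then $$\sigma_{\mathrm{ess}}(T_a)=\bigcup_{\eta\in[-\pi,\pi]}\sigma(T_{a,\eta}),\qquad\text{and moreover}\qquad \sigma(T_a)=\sigma_{\mathrm{ess}}(T_a).$$ -/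

import Mathlib

open MeasureTheory Set Filter Topology
open scoped ENNReal

noncomputable section

/-! ### Bergman spaces -/

/-- The Bergman space `A²(Ω)` of an open set `Ω ⊆ ℂ`: the subspace of `L²(Ω)` (area measure) of the
classes that have a representative holomorphic in `Ω`. -/
def bergmanSpace (Ω : TopologicalSpace.Opens ℂ) :
    Submodule ℂ (Lp ℂ 2 (volume.restrict (Ω : Set ℂ))) where
  carrier := {f | ∃ g : ℂ → ℂ, DifferentiableOn ℂ g Ω ∧ f =ᵐ[volume.restrict (Ω : Set ℂ)] g}
  zero_mem' := ⟨fun _ => 0, differentiableOn_const 0, Lp.coeFn_zero _ _ _⟩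
  add_mem' := by
    rintro f₁ f₂ ⟨g₁, h₁, e₁⟩ ⟨g₂, h₂, e₂⟩
    exact ⟨g₁ + g₂, h₁.add h₂, (Lp.coeFn_add f₁ f₂).trans (e₁.add e₂)⟩
  smul_mem' := by
    rintro c f ⟨g, h, e⟩
    exact ⟨c • g, h.const_smul c, (Lp.coeFn_smul c f).trans (e.const_smul c)⟩

/-- Sub-mean-value inequality over a disc for a holomorphic function. -/
theorem bergman_area_bound {g : ℂ → ℂ} {c : ℂ} {R : ℝ} (hR : 0 < R)
    (hg : DifferentiableOn ℂ g (Metric.closedBall c R)) :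
    ENNReal.ofReal (R / 2 * (R / 2)) * ‖g c‖ₑ ≤ ∫⁻ z in Metric.ball c R, ‖g z‖ₑ := by
  classical
  have hmeas : Measurable ((Metric.ball (0 : ℂ) R).indicator fun w => ‖g (c + w)‖ₑ) := by
    rw [← piecewise_eq_indicator]
    refine ContinuousOn.measurable_piecewise ?_ continuousOn_const measurableSet_ball
    refine continuous_enorm.comp_continuousOn (hg.continuousOn.comp (by fun_prop) ?_)
    intro w hw
    simpa using (mem_ball_zero_iff.1 hw).le
  have h1 : ∫⁻ z in Metric.ball c R, ‖g z‖ₑ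
      = ∫⁻ w, (Metric.ball (0 : ℂ) R).indicator (fun w => ‖g (c + w)‖ₑ) w := by
    rw [← lintegral_indicator measurableSet_ball, ← lintegral_add_left_eq_self _ c]
    refine lintegral_congr fun w => ?_
    simp only [indicator, Metric.mem_ball, dist_self_add_left, dist_zero_right]
  have hcirc : ∀ r ∈ Ioo (R / 2) R, ‖g c‖ₑ ≤
      ∫⁻ θ in Ioo (-Real.pi) Real.pi, ‖g (c + Complex.polarCoord.symm (r, θ))‖ₑ := by
    intro r hr
    have hr0 : 0 < r := by linarith [hr.1]
    have hd : DiffContOnCl ℂ g (Metric.ball c |r|) := by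
      apply DifferentiableOn.diffContOnCl
      refine hg.mono ?_
      rw [abs_of_pos hr0]
      exact Metric.closure_ball_subset_closedBall.trans (Metric.closedBall_subset_closedBall hr.2.le)
    have hmv := hd.circleAverage
    rw [Real.circleAverage_eq_integral_add (-Real.pi),
      intervalIntegral.integral_comp_add_right (fun θ => g (circleMap c r θ))] at hmv
    have e1 : (0 : ℝ) + -Real.pi = -Real.pi := by ring
    have e2 : 2 * Real.pi + -Real.pi = Real.pi := by ring
    rw [e1, e2, intervalIntegral.integral_of_le (by linarith [Real.pi_pos]),
      integral_Ioc_eq_integral_Ioo] at hmv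
    have hpi : ‖(2 * Real.pi)⁻¹‖ₑ ≤ 1 := by
      rw [← ofReal_norm, ← ENNReal.ofReal_one]
      apply ENNReal.ofReal_le_ofReal
      rw [Real.norm_of_nonneg (by positivity)]
      exact inv_le_one_of_one_le₀ (by linarith [Real.two_le_pi])
    calc ‖g c‖ₑ = ‖(2 * Real.pi)⁻¹‖ₑ * ‖∫ θ in Ioo (-Real.pi) Real.pi, g (circleMap c r θ)‖ₑ := by
          rw [← hmv, enorm_smul]
      _ ≤ ‖∫ θ in Ioo (-Real.pi) Real.pi, g (circleMap c r θ)‖ₑ := mul_le_of_le_one_left' hpi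
      _ ≤ ∫⁻ θ in Ioo (-Real.pi) Real.pi, ‖g (circleMap c r θ)‖ₑ :=
          enorm_integral_le_lintegral_enorm _
      _ = _ := by
          refine lintegral_congr fun θ => ?_
          simp [circleMap, Complex.exp_mul_I]
  rw [h1, ← Complex.lintegral_comp_polarCoord_symm, polarCoord_target, Measure.volume_eq_prod,
    ← Measure.prod_restrict, lintegral_prod _ (by
      refine Measurable.aemeasurable ?_
      have hp : (Complex.polarCoord.symm : ℝ × ℝ → ℂ) =
          fun p => p.1 * (Real.cos p.2 + Real.sin p.2 * Complex.I) :=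
        funext Complex.polarCoord_symm_apply
      refine (ENNReal.measurable_ofReal.comp measurable_fst).mul (hmeas.comp ?_)
      rw [hp]
      fun_prop)]
  calc ENNReal.ofReal (R / 2 * (R / 2)) * ‖g c‖ₑ
      = ∫⁻ r in Ioo (R / 2) R, ENNReal.ofReal (R / 2) * ‖g c‖ₑ := by
        rw [setLIntegral_const, Real.volume_Ioo, ENNReal.ofReal_mul (by positivity)]
        rw [show R - R / 2 = R / 2 by ring]
        ring
    _ ≤ ∫⁻ r in Ioo (R / 2) R, ∫⁻ θ in Ioo (-Real.pi) Real.pi, ENNReal.ofReal r •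
          (Metric.ball (0 : ℂ) R).indicator (fun w => ‖g (c + w)‖ₑ)
            (Complex.polarCoord.symm (r, θ)) := by
        refine setLIntegral_mono' measurableSet_Ioo fun r hr => ?_
        have hr0 : 0 < r := by linarith [hr.1]
        have hin : ∀ θ : ℝ, Complex.polarCoord.symm (r, θ) ∈ Metric.ball (0 : ℂ) R := by
          intro θ
          rw [mem_ball_zero_iff, Complex.norm_polarCoord_symm, abs_of_pos hr0]
          exact hr.2
        simp only [smul_eq_mul, indicator_of_mem (hin _)]
        rw [lintegral_const_mul' _ _ ENNReal.ofReal_ne_top]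
        exact mul_le_mul' (ENNReal.ofReal_le_ofReal hr.1.le) (hcirc r hr)
    _ ≤ _ := lintegral_mono_set fun r hr => lt_trans (by linarith) hr.1

/-- Point evaluations on a Bergman space are bounded by the `L²` norm, locally uniformly. -/
theorem bergman_pointwise_bound {R : ℝ} (hR : 0 < R) :
    ∃ K : ℝ, ∀ (Ω : Set ℂ) (g : ℂ → ℂ) (c : ℂ), DifferentiableOn ℂ g Ω →
      Metric.closedBall c R ⊆ Ω → ∀ f : Lp ℂ 2 (volume.restrict Ω),
      f =ᵐ[volume.restrict Ω] g → ‖g c‖ ≤ K * ‖f‖ := by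
  have hV : ∀ c : ℂ, volume (Metric.ball c R) = volume (Metric.ball (0 : ℂ) R) := fun c => by
    simp [Complex.volume_ball]
  set V : ℝ≥0∞ := volume (Metric.ball (0 : ℂ) R) ^
    ((1 : ℝ) / (1 : ℝ≥0∞).toReal - 1 / (2 : ℝ≥0∞).toReal) with hVdef
  have hVt : V ≠ ∞ := by
    rw [hVdef]
    exact ENNReal.rpow_ne_top_of_nonneg (by norm_num) measure_ball_lt_top.ne
  refine ⟨(R / 2 * (R / 2))⁻¹ * V.toReal, fun Ω g c hg hsub f hfg => ?_⟩
  have hb := bergman_area_bound hR (hg.mono hsub)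
  have hball : Metric.ball c R ⊆ Ω := Metric.ball_subset_closedBall.trans hsub
  have hmono : volume.restrict (Metric.ball c R) ≤ volume.restrict Ω :=
    Measure.restrict_mono hball le_rfl
  have hgm : AEStronglyMeasurable g (volume.restrict (Metric.ball c R)) :=
    ((Lp.memLp f).1.congr hfg).mono_measure hmono
  have h2 : ∫⁻ z in Metric.ball c R, ‖g z‖ₑ ≤ eLpNorm g 2 (volume.restrict Ω) * V := by
    rw [← eLpNorm_one_eq_lintegral_enorm]
    refine (eLpNorm_le_eLpNorm_mul_rpow_measure_univ (p := 1) (q := 2) (by norm_num) hgm).trans ?_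
    rw [Measure.restrict_apply_univ, hV]
    exact mul_le_mul' (eLpNorm_mono_measure _ hmono) le_rfl
  have h3 : eLpNorm g 2 (volume.restrict Ω) = ENNReal.ofReal ‖f‖ := by
    rw [← eLpNorm_congr_ae hfg, Lp.norm_def, ENNReal.ofReal_toReal (Lp.eLpNorm_ne_top f)]
  have h4 := hb.trans h2
  rw [h3, ← ofReal_norm, ← ENNReal.ofReal_toReal hVt,
    ← ENNReal.ofReal_mul (by positivity), ← ENNReal.ofReal_mul (norm_nonneg _),
    ENNReal.ofReal_le_ofReal_iff (by positivity)] at h4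
  rw [mul_assoc, ← div_eq_inv_mul, le_div_iff₀ (by positivity)]
  linarith

/-- The Bergman space is closed in `L²(Ω)`. -/
theorem isClosed_bergmanSpace (Ω : TopologicalSpace.Opens ℂ) :
    IsClosed (bergmanSpace Ω : Set (Lp ℂ 2 (volume.restrict (Ω : Set ℂ)))) := by
  refine IsSeqClosed.isClosed fun u f hu huf => ?_
  choose g hg hug using hu
  have hcauchy : CauchySeq u := huf.cauchySeq
  have huc : ∀ z₀ ∈ (Ω : Set ℂ), ∃ r > 0, Metric.ball z₀ r ⊆ Ω ∧
      UniformCauchySeqOn g atTop (Metric.ball z₀ r) := by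
    intro z₀ hz₀
    obtain ⟨s, hs, hsub⟩ := Metric.isOpen_iff.1 Ω.isOpen z₀ hz₀
    obtain ⟨K, hK⟩ := bergman_pointwise_bound (R := s / 2) (by positivity)
    refine ⟨s / 2, by positivity, (Metric.ball_subset_ball (by linarith)).trans hsub, ?_⟩
    rw [Metric.uniformCauchySeqOn_iff]
    intro ε hε
    obtain ⟨N, hN⟩ := Metric.cauchySeq_iff.1 hcauchy (ε / (|K| + 1)) (by positivity)
    refine ⟨N, fun m hm n hn z hz => ?_⟩
    have hzs : Metric.closedBall z (s / 2) ⊆ Ω := by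
      refine Subset.trans (fun w hw => ?_) hsub
      rw [Metric.mem_ball] at hz ⊢
      rw [Metric.mem_closedBall] at hw
      linarith [dist_triangle w z z₀]
    have hb := hK Ω (g m - g n) z ((hg m).sub (hg n)) hzs (u m - u n)
      ((Lp.coeFn_sub _ _).trans ((hug m).sub (hug n)))
    have hd := hN m hm n hn
    rw [dist_eq_norm] at hd ⊢
    rw [Pi.sub_apply] at hb
    rw [lt_div_iff₀ (by positivity)] at hd
    nlinarith [norm_nonneg (u m - u n), le_abs_self K, abs_nonneg K]
  have hlim : ∀ z ∈ (Ω : Set ℂ), ∃ l, Tendsto (fun n => g n z) atTop (𝓝 l) := by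
    intro z hz
    obtain ⟨r, hr, -, h⟩ := huc z hz
    exact cauchySeq_tendsto_of_complete (h.cauchySeq (Metric.mem_ball_self hr))
  choose! G hG using hlim
  have hloc : TendstoLocallyUniformlyOn g G atTop (Ω : Set ℂ) := by
    refine tendstoLocallyUniformlyOn_of_forall_exists_nhds fun z hz => ?_
    obtain ⟨r, hr, hrs, h⟩ := huc z hz
    exact ⟨Metric.ball z r, mem_nhdsWithin_of_mem_nhds (Metric.ball_mem_nhds z hr),
      h.tendstoUniformlyOn_of_tendsto fun w hw => hG w (hrs hw)⟩
  refine ⟨G, hloc.differentiableOn (Eventually.of_forall hg) Ω.isOpen, ?_⟩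
  obtain ⟨ns, hns, hae⟩ := (tendstoInMeasure_of_tendsto_Lp huf).exists_seq_tendsto_ae
  filter_upwards [hae, ae_all_iff.2 hug, ae_restrict_mem Ω.isOpen.measurableSet] with z h1 h2 h3
  refine tendsto_nhds_unique h1 ?_
  simp only [h2]
  exact (hG z h3).comp hns.tendsto_atTop

instance (Ω : TopologicalSpace.Opens ℂ) : CompleteSpace (bergmanSpace Ω) :=
  (isClosed_bergmanSpace Ω).completeSpace_coe

/-! ### Toeplitz operators -/

/-- Multiplication `f ↦ a f` on `L²(Ω)` by a function `a ∈ L^∞(Ω)`. -/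
def mulOperator {Ω : Set ℂ} {a : ℂ → ℂ} (ha : MemLp a ∞ (volume.restrict Ω)) :
    Lp ℂ 2 (volume.restrict Ω) →L[ℂ] Lp ℂ 2 (volume.restrict Ω) :=
  (ContinuousLinearMap.mul ℂ ℂ).holderL (volume.restrict Ω) ∞ 2 2 ha.toLp

theorem coeFn_mulOperator {Ω : Set ℂ} {a : ℂ → ℂ} (ha : MemLp a ∞ (volume.restrict Ω))
    (f : Lp ℂ 2 (volume.restrict Ω)) :
    mulOperator ha f =ᵐ[volume.restrict Ω] fun z => a z * f z := by
  filter_upwards [(ContinuousLinearMap.mul ℂ ℂ).coeFn_holder (r := 2) ha.toLp f, ha.coeFn_toLp]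
    with z h1 h2
  rw [← h2]
  exact h1

/-- The Toeplitz operator `f ↦ P (a f)` on a closed subspace `A` of `L²(Ω)`, where `P` is the
orthogonal projection of `L²(Ω)` onto `A`. -/
def toeplitzOn {Ω : Set ℂ} (A : Submodule ℂ (Lp ℂ 2 (volume.restrict Ω)))
    [A.HasOrthogonalProjection] {a : ℂ → ℂ} (ha : MemLp a ∞ (volume.restrict Ω)) : A →L[ℂ] A :=
  A.orthogonalProjectionOnto ∘L mulOperator ha ∘L A.subtypeL

/-- The Bergman–Toeplitz operator `T_a : A²(Ω) → A²(Ω)`, `T_a f = P_Ω (a f)`. -/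
def bergmanToeplitz (Ω : TopologicalSpace.Opens ℂ) {a : ℂ → ℂ}
    (ha : MemLp a ∞ (volume.restrict (Ω : Set ℂ))) : bergmanSpace Ω →L[ℂ] bergmanSpace Ω :=
  toeplitzOn (bergmanSpace Ω) ha

/-- The essential spectrum of a bounded operator: the `z` for which `T - z I` is not Fredholm. -/
def essentialSpectrum {H : Type*} [NormedAddCommGroup H] [InnerProductSpace ℂ H]
    (T : H →L[ℂ] H) : Set ℂ :=
  {z | ¬ (T - z • ContinuousLinearMap.id ℂ H).IsFredholm}

/-! ### Periodic domains -/

/-- `Ω` has Lipschitz boundary: near each boundary point, in suitable Cartesian coordinates (a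
translation followed by a rotation `u`), `Ω` is the region above the graph of a Lipschitz function
of one real variable. -/
def HasLipschitzBoundary (Ω : Set ℂ) : Prop :=
  ∀ p ∈ frontier Ω, ∃ (u : Circle) (r : ℝ) (K : NNReal) (φ : ℝ → ℝ), 0 < r ∧ LipschitzWith K φ ∧
    ∀ z ∈ Metric.ball p r, z ∈ Ω ↔ φ ((u : ℂ) * (z - p)).re < ((u : ℂ) * (z - p)).im

/-- A periodicity cell: a Lipschitz domain `ϖ ⊆ ]0,1[ × ]-M,M[` whose boundary meets the lines
`Re z = 0` and `Re z = 1` exactly in `{0} × [lower, upper]` and `{1} × [lower, upper]`. -/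
structure PeriodicCell where
  /-- The open set `ϖ`. -/
  carrier : TopologicalSpace.Opens ℂ
  /-- The lower end of the lateral sides. -/
  lower : ℝ
  /-- The upper end of the lateral sides. -/
  upper : ℝ
  lower_lt_upper : lower < upper
  isConnected : IsConnected (carrier : Set ℂ)
  subset_strip : ∃ M : ℝ, 0 < M ∧ (carrier : Set ℂ) ⊆ Ioo 0 1 ×ℂ Ioo (-M) M
  lipschitz : HasLipschitzBoundary (carrier : Set ℂ)
  frontier_left : frontier (carrier : Set ℂ) ∩ {z | z.re = 0} = {0} ×ℂ Icc lower upper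
  frontier_right : frontier (carrier : Set ℂ) ∩ {z | z.re = 1} = {1} ×ℂ Icc lower upper

namespace PeriodicCell

/-- The periodic domain `Π`: the interior of the union of the closures of all the integer
translates `ϖ + m` of the cell. -/
def domain (C : PeriodicCell) : TopologicalSpace.Opens ℂ :=
  ⟨interior (⋃ m : ℤ, closure ((fun z : ℂ => z + m) '' (C.carrier : Set ℂ))), isOpen_interior⟩

theorem carrier_subset_domain (C : PeriodicCell) : (C.carrier : Set ℂ) ⊆ C.domain := by
  refine interior_maximal (fun z hz => mem_iUnion.2 ⟨0, subset_closure ⟨z, hz, by simp⟩⟩)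
    C.carrier.isOpen

/-- The restriction `a|_ϖ` of a bounded symbol on `Π`. -/
theorem memLp_carrier (C : PeriodicCell) {a : ℂ → ℂ}
    (ha : MemLp a ∞ (volume.restrict (C.domain : Set ℂ))) :
    MemLp a ∞ (volume.restrict (C.carrier : Set ℂ)) :=
  ha.mono_measure (Measure.restrict_mono C.carrier_subset_domain le_rfl)

/-- The space `A²_{η,ext}(ϖ)`: the `f ∈ A²(ϖ)` that extend holomorphically to a neighbourhood `U` in
`Π` of `cl(ϖ) ∩ Π`, with `f (1 + i y) = e^{i η} f (i y)` for `lower < y < upper`. -/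
def quasiperiodicExt (C : PeriodicCell) (η : ℝ) :
    Submodule ℂ (Lp ℂ 2 (volume.restrict (C.carrier : Set ℂ))) where
  carrier := {f | f ∈ bergmanSpace C.carrier ∧ ∃ (U : Set ℂ) (g : ℂ → ℂ), IsOpen U ∧
    closure (C.carrier : Set ℂ) ∩ C.domain ⊆ U ∧ U ⊆ C.domain ∧ DifferentiableOn ℂ g U ∧
    f =ᵐ[volume.restrict (C.carrier : Set ℂ)] g ∧
    ∀ y ∈ Ioo C.lower C.upper,
      g (1 + Complex.I * y) = Complex.exp (Complex.I * η) * g (Complex.I * y)}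
  zero_mem' := ⟨zero_mem _, C.domain, fun _ => 0, C.domain.isOpen, inter_subset_right,
    Subset.rfl, differentiableOn_const 0, Lp.coeFn_zero _ _ _, by simp⟩
  add_mem' := by
    rintro f₁ f₂ ⟨m₁, U₁, g₁, o₁, c₁, s₁, d₁, e₁, q₁⟩ ⟨m₂, U₂, g₂, o₂, c₂, s₂, d₂, e₂, q₂⟩
    refine ⟨add_mem m₁ m₂, U₁ ∩ U₂, g₁ + g₂, o₁.inter o₂, subset_inter c₁ c₂,
      inter_subset_left.trans s₁, (d₁.mono inter_subset_left).add (d₂.mono inter_subset_right),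
      (Lp.coeFn_add f₁ f₂).trans (e₁.add e₂), fun y hy => ?_⟩
    simp only [Pi.add_apply, q₁ y hy, q₂ y hy]
    ring
  smul_mem' := by
    rintro c f ⟨m, U, g, o, cl, s, d, e, q⟩
    refine ⟨Submodule.smul_mem _ c m, U, c • g, o, cl, s, d.const_smul c,
      (Lp.coeFn_smul c f).trans (e.const_smul c), fun y hy => ?_⟩
    simp only [Pi.smul_apply, smul_eq_mul, q y hy]
    ring

/-- The space `A²_η(ϖ)`: the closure of `A²_{η,ext}(ϖ)`. As `A²(ϖ)` is closed in `L²(ϖ)`, the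
closures in these two spaces agree. -/
def quasiperiodicSpace (C : PeriodicCell) (η : ℝ) :
    Submodule ℂ (Lp ℂ 2 (volume.restrict (C.carrier : Set ℂ))) :=
  (C.quasiperiodicExt η).topologicalClosure

theorem quasiperiodicSpace_le (C : PeriodicCell) (η : ℝ) :
    C.quasiperiodicSpace η ≤ bergmanSpace C.carrier :=
  Submodule.topologicalClosure_minimal _ (fun _ hf => hf.1) (isClosed_bergmanSpace _)

instance (C : PeriodicCell) (η : ℝ) : CompleteSpace (C.quasiperiodicSpace η) :=
  (Submodule.isClosed_topologicalClosure _).completeSpace_coe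

/-- The cell operator `T_{a,η} : A²_η(ϖ) → A²_η(ϖ)`, `T_{a,η} f = P_η (a|_ϖ f)`. -/
def cellToeplitz (C : PeriodicCell) {a : ℂ → ℂ}
    (ha : MemLp a ∞ (volume.restrict (C.domain : Set ℂ))) (η : ℝ) :
    C.quasiperiodicSpace η →L[ℂ] C.quasiperiodicSpace η :=
  toeplitzOn (C.quasiperiodicSpace η) (C.memLp_carrier ha)

end PeriodicCell

end

/-!
Write `T_a` for the Toeplitz operator on `A²(Π)` and `T_{a,η}` for the operators on the cell.

*The spectrum is essential.* The operator `T_a - c` commutes with the unitary translation by `1`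
on `A²(Π)`. The translation has no eigenvectors, since an eigenvector would have the same norm on
each of the infinitely many cells. If `T_a - c` is Fredholm, its kernel and that of its adjoint are
finite-dimensional and translation invariant, so both vanish and `T_a - c` is invertible
(`isUnit_of_isFredholm_of_commute`).

*The spectrum is the union of the fiber spectra.* It is shown that `T_a - c` is invertible if and
only if `T_{a,η} - c` is invertible for every `η ∈ [-π, π]`. A bounded operator on a Hilbert space
is invertible exactly when it and its adjoint are bounded below, and this can be read off from its
sesquilinear form on a dense set. Hence operators whose forms correspond to each other under a
densely defined correspondence with equivalent norms are simultaneously invertible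
(`isUnit_iff_of_pairing`). This is used twice.

* Multiplication by `e^{i η z}` maps `A²_0(ϖ)` onto `A²_η(ϖ)`. It turns `T_{a,η} - c` into an
  operator `B_η` on the fixed space `V = A²_0(ϖ)`, norm-continuous in `η`
  (`PeriodicCell.isUnit_cellToeplitz_iff`). By continuity, multiplication by `B` on `L²([-π, π]; V)`
  is invertible if and only if all the `B_η` are (`isUnit_lpMul_iff`).
* The Floquet transform `∑ₘ e^{-i η m} F(z + m)` turns `T_a - c` into multiplication by `B`, by
  Parseval's identity and the periodicity of `a` (`isUnit_iff_forall_fiber`). To avoid convergence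
  questions it is only applied to functions `F = ζ⁻² f` with `f ∈ A²(Π)`, where `ζ = c₀ - i z` with
  a constant `c₀` for which `Re ζ ≥ 1` in `Π`. The series then converges absolutely in `L²(ϖ)` and
  locally uniformly in `Π`, so that its sum belongs to `A²_{η,ext}(ϖ)`; and such `F` are dense
  because `Re ζ⁻¹ > 0` (`PeriodicCell.denseRange_weightMul`).

It remains to see that the transforms are dense in `L²([-π, π]; V)`. By the identity theorem, a
function `v ∈ A²_{0,ext}(ϖ)` extends to a periodic holomorphic function on `Π`
(`PeriodicCell.mem_quasiperiodicExt_iff`). Its product with the Fourier–Laplace transform of a test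
function `χ` on `]-π, π[`, an entire function that decays rapidly along `Π`, has the Floquet
transform `χ(η) e^{i η z} v` (`PeriodicCell.exists_fiberCoord_eq`), and the functions `χ v` span a
dense subspace.
-/

noncomputable section

/-! ### Invertibility of operators between Hilbert spaces -/

theorem exists_eigenvector_of_invariant {E : Type*} [AddCommGroup E] [Module ℂ E]
    {τ : E →ₗ[ℂ] E} {W : Submodule ℂ E} [FiniteDimensional ℂ W] (hW : W ≠ ⊥)
    (h : ∀ x ∈ W, τ x ∈ W) :
    ∃ x ≠ 0, ∃ μ : ℂ, τ x = μ • x := by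
  have : Nontrivial W := Submodule.nontrivial_iff_ne_bot.2 hW
  obtain ⟨μ, hμ⟩ := Module.End.exists_eigenvalue (τ.restrict h)
  obtain ⟨v, hv⟩ := hμ.exists_hasEigenvector
  refine ⟨v, by simpa using hv.2, μ, ?_⟩
  have := congrArg Subtype.val hv.apply_eq_smul
  simpa using this

section Abstract

variable {A K : Type*} [NormedAddCommGroup A] [InnerProductSpace ℂ A] [CompleteSpace A]
  [NormedAddCommGroup K] [InnerProductSpace ℂ K] [CompleteSpace K]

theorem isUnit_iff_bddBelow (T : A →L[ℂ] A) :
    IsUnit T ↔ (∃ c > 0, ∀ x, c * ‖x‖ ≤ ‖T x‖) ∧ ∃ c > 0, ∀ x, c * ‖x‖ ≤ ‖T.adjoint x‖ := by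
  have key : ∀ S : A →L[ℂ] A, IsUnit S → ∃ c > 0, ∀ x, c * ‖x‖ ≤ ‖S x‖ := by
    rintro S ⟨u, rfl⟩
    refine ⟨(‖(↑u⁻¹ : A →L[ℂ] A)‖ + 1)⁻¹, by positivity, fun x => ?_⟩
    have h1 : (↑u⁻¹ : A →L[ℂ] A) ((u : A →L[ℂ] A) x) = x := by
      rw [← mul_apply_eq_comp, Units.inv_mul, one_apply_eq_self]
    have h2 := (↑u⁻¹ : A →L[ℂ] A).le_opNorm ((u : A →L[ℂ] A) x)
    rw [h1] at h2
    rw [inv_mul_le_iff₀ (by positivity)]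
    nlinarith [norm_nonneg ((u : A →L[ℂ] A) x)]
  constructor
  · intro h
    refine ⟨key T h, key _ ?_⟩
    rw [← ContinuousLinearMap.star_eq_adjoint]
    exact h.star
  · rintro ⟨⟨c, hc, h⟩, d, hd, h'⟩
    rw [ContinuousLinearMap.isUnit_iff_bijective,
      ContinuousLinearMap.bijective_iff_dense_range_and_antilipschitz]
    refine ⟨?_, ⟨c.toNNReal⁻¹, ?_⟩⟩
    · rw [Submodule.topologicalClosure_eq_top_iff, ContinuousLinearMap.orthogonal_range,
        Submodule.eq_bot_iff]
      intro x hx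
      have h0 : T.adjoint x = 0 := hx
      have := h' x
      rw [h0, norm_zero] at this
      have : ‖x‖ ≤ 0 := by
        by_contra hne
        push Not at hne
        nlinarith [mul_pos hd hne]
      exact norm_le_zero_iff.1 this
    · refine ContinuousLinearMap.antilipschitz_of_bound T fun x => ?_
      rw [NNReal.coe_inv, Real.coe_toNNReal _ hc.le, inv_mul_eq_div, le_div_iff₀ hc, mul_comm]
      exact h x

omit [CompleteSpace A] [CompleteSpace K] in
/-- One half of `isUnit_iff_of_pairing`. -/
theorem bddBelow_of_pairing {X : Type*} {N : X → A} {G : X → K} (hN : DenseRange N)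
    (hG : DenseRange G) {k : ℂ} {D : ℝ}
    (hGN : ∀ x, ‖G x‖ ≤ D * ‖N x‖) {R : A →L[ℂ] A} {S : K →L[ℂ] K}
    (h : ∀ x y, inner ℂ (N y) (R (N x)) = k * inner ℂ (G y) (S (G x)))
    (hR : ∃ c > 0, ∀ x, c * ‖x‖ ≤ ‖R x‖) : ∃ c > 0, ∀ x, c * ‖x‖ ≤ ‖S x‖ := by
  obtain ⟨c, hc, hR⟩ := hR
  set D' := |D| + 1
  have hD' : 0 < D' := by positivity
  have hGN' : ∀ x, ‖G x‖ ≤ D' * ‖N x‖ := fun x => (hGN x).trans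
    (mul_le_mul_of_nonneg_right ((le_abs_self D).trans (by simp [D'])) (norm_nonneg _))
  -- testing against vectors `N y` close to `R (N x)` bounds `R (N x)` by `S (G x)`
  have h1 : ∀ x, ‖R (N x)‖ ≤ ‖k‖ * D' * ‖S (G x)‖ := by
    intro x
    have h2 : ∀ a : A, ‖inner ℂ a (R (N x))‖ ≤ ‖k‖ * D' * ‖S (G x)‖ * ‖a‖ := by
      intro a
      refine hN.induction_on a (isClosed_le (by fun_prop) (by fun_prop)) fun y => ?_
      rw [h, norm_mul]
      calc ‖k‖ * ‖inner ℂ (G y) (S (G x))‖ ≤ ‖k‖ * (‖G y‖ * ‖S (G x)‖) := by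
            gcongr; exact norm_inner_le_norm _ _
        _ ≤ ‖k‖ * (D' * ‖N y‖ * ‖S (G x)‖) := by gcongr; exact hGN' y
        _ = _ := by ring
    have h3 := h2 (R (N x))
    rw [inner_self_eq_norm_sq_to_K, norm_pow, RCLike.norm_ofReal, abs_norm, sq] at h3
    rcases (norm_nonneg (R (N x))).eq_or_lt with h0 | h0
    · rw [← h0]; positivity
    · exact le_of_mul_le_mul_right h3 h0
  set E := ‖k‖ * D' + 1
  have hE : 0 < E := by positivity
  refine ⟨c / (D' * E), by positivity, fun a => ?_⟩
  refine hG.induction_on a (isClosed_le (by fun_prop) (by fun_prop)) fun x => ?_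
  rw [div_mul_eq_mul_div, div_le_iff₀ (by positivity)]
  have h4 : ‖R (N x)‖ ≤ E * ‖S (G x)‖ := (h1 x).trans
    (mul_le_mul_of_nonneg_right (by simp [E]) (norm_nonneg _))
  calc c * ‖G x‖ ≤ c * (D' * ‖N x‖) := by gcongr; exact hGN' x
    _ = D' * (c * ‖N x‖) := by ring
    _ ≤ D' * (E * ‖S (G x)‖) := mul_le_mul_of_nonneg_left ((hR _).trans h4) hD'.le
    _ = _ := by ring

/-- Two operators `R` on `A` and `S` on `K` whose sesquilinear forms correspond to each other under
a densely defined correspondence `N x ↔ G x` with equivalent norms are simultaneously invertible.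
Invertibility amounts to `R` and its adjoint being bounded below, and both properties can be read
off from the forms. -/
theorem isUnit_iff_of_pairing {X : Type*} {N : X → A} {G : X → K} (hN : DenseRange N)
    (hG : DenseRange G) {k : ℂ} (hk : k ≠ 0) {C D : ℝ} (hNG : ∀ x, ‖N x‖ ≤ C * ‖G x‖)
    (hGN : ∀ x, ‖G x‖ ≤ D * ‖N x‖) {R : A →L[ℂ] A} {S : K →L[ℂ] K}
    (h : ∀ x y, inner ℂ (N y) (R (N x)) = k * inner ℂ (G y) (S (G x))) :
    IsUnit R ↔ IsUnit S := by
  have h' : ∀ x y, inner ℂ (N y) (R.adjoint (N x))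
      = (starRingEnd ℂ) k * inner ℂ (G y) (S.adjoint (G x)) := by
    intro x y
    rw [ContinuousLinearMap.adjoint_inner_right, ContinuousLinearMap.adjoint_inner_right,
      ← inner_conj_symm, h, map_mul, inner_conj_symm]
  have hk' : (starRingEnd ℂ) k ≠ 0 := by simpa using hk
  rw [isUnit_iff_bddBelow, isUnit_iff_bddBelow]
  constructor
  · rintro ⟨h1, h2⟩
    exact ⟨bddBelow_of_pairing hN hG hGN h h1, bddBelow_of_pairing hN hG hGN h' h2⟩
  · rintro ⟨h1, h2⟩
    refine ⟨bddBelow_of_pairing hG hN hNG (k := k⁻¹) (fun x y => ?_) h1,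
      bddBelow_of_pairing hG hN hNG (k := ((starRingEnd ℂ) k)⁻¹) (fun x y => ?_) h2⟩
    · rw [h, inv_mul_cancel_left₀ hk]
    · rw [h', inv_mul_cancel_left₀ hk']

/-- A Fredholm operator commuting with a unitary operator without eigenvectors is invertible: the
kernels of the operator and of its adjoint are finite-dimensional and invariant, hence zero. -/
theorem isUnit_of_isFredholm_of_commute {T : A →L[ℂ] A} (hT : T.IsFredholm) (τ : A ≃ₗᵢ[ℂ] A)
    (hc : ∀ x, T (τ x) = τ (T x)) (hτ : ∀ (x : A) (μ : ℂ), τ x = μ • x → x = 0) : IsUnit T := by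
  have hc' : ∀ x, T.adjoint (τ x) = τ (T.adjoint x) := by
    intro x
    refine ext_inner_left ℂ fun y => ?_
    obtain ⟨z, rfl⟩ := τ.surjective y
    rw [ContinuousLinearMap.adjoint_inner_right, hc, τ.inner_map_map, τ.inner_map_map,
      ContinuousLinearMap.adjoint_inner_right]
  have hinv : ∀ S : A →L[ℂ] A, (∀ x, S (τ x) = τ (S x)) → FiniteDimensional ℂ S.ker →
      S.ker = ⊥ := by
    intro S hS hfin
    by_contra hne
    obtain ⟨x, hx, μ, hμ⟩ := exists_eigenvector_of_invariant (τ := τ.toLinearEquiv.toLinearMap)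
      hne (fun x hx => by
        have h0 : S x = 0 := hx
        change S (τ x) = 0
        rw [hS, h0, map_zero])
    exact hx (hτ x μ hμ)
  have hcofin : FiniteDimensional ℂ T.adjoint.ker := by
    rw [← ContinuousLinearMap.orthogonal_range]
    have h1 : FiniteDimensional ℂ (A ⧸ T.range) := hT.finite_coker
    have hcl : CompleteSpace T.range := hT.isClosed_range.completeSpace_coe
    exact (Submodule.quotientEquivOfIsCompl _ _
      T.range.isCompl_orthogonal).finiteDimensional
  rw [ContinuousLinearMap.isUnit_iff_bijective]
  refine ⟨LinearMap.ker_eq_bot.1 (hinv T hc hT.finite_ker), ?_⟩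
  have h2 := hinv _ hc' hcofin
  rw [← ContinuousLinearMap.orthogonal_range, ← Submodule.topologicalClosure_eq_top_iff,
    hT.isClosed_range.submodule_topologicalClosure_eq] at h2
  exact LinearMap.range_eq_top.1 h2

omit [CompleteSpace A] in
theorem isFredholm_of_isUnit {T : A →L[ℂ] A} (hT : IsUnit T) : T.IsFredholm := by
  obtain ⟨u, rfl⟩ := hT
  let e : A ≃L[ℂ] A := ContinuousLinearEquiv.unitsEquiv ℂ A u
  exact ContinuousLinearMap.IsFredholm.of_isQuasiInverse (v := (e.symm : A →L[ℂ] A))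
    e.toLinearEquiv.isQuasiInverse

end Abstract

/-! ### Multiplication by operator-valued functions and Fourier series -/

section VectorValued

variable {V : Type*} [NormedAddCommGroup V] [InnerProductSpace ℂ V] [CompleteSpace V]

theorem memLp_top_of_continuousOn {E : Type*} [NormedAddCommGroup E] {B : ℝ → E} {a b : ℝ}
    (hB : ContinuousOn B (Icc a b)) : MemLp B ∞ (volume.restrict (Icc a b)) := by
  obtain ⟨C, hC⟩ := isCompact_Icc.exists_bound_of_continuousOn hB
  exact memLp_top_of_bound (hB.aestronglyMeasurable measurableSet_Icc) C
    ((ae_restrict_iff' measurableSet_Icc).2 (Eventually.of_forall hC))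

/-- The operator `u ↦ (η ↦ B η (u η))` on `L²([a, b]; V)` given by a continuous operator-valued
function `B`. -/
def lpMul {a b : ℝ} {B : ℝ → V →L[ℂ] V} (hB : ContinuousOn B (Icc a b)) :
    Lp V 2 (volume.restrict (Icc a b)) →L[ℂ] Lp V 2 (volume.restrict (Icc a b)) :=
  (ContinuousLinearMap.id ℂ (V →L[ℂ] V)).holderL (volume.restrict (Icc a b)) ∞ 2 2
    (memLp_top_of_continuousOn hB).toLp

theorem coeFn_lpMul {a b : ℝ} {B : ℝ → V →L[ℂ] V} (hB : ContinuousOn B (Icc a b))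
    (u : Lp V 2 (volume.restrict (Icc a b))) :
    lpMul hB u =ᵐ[volume.restrict (Icc a b)] fun η => B η (u η) := by
  filter_upwards [(ContinuousLinearMap.id ℂ (V →L[ℂ] V)).coeFn_holder (r := 2)
    (memLp_top_of_continuousOn hB).toLp u, (memLp_top_of_continuousOn hB).coeFn_toLp] with η h1 h2
  rw [← h2]
  exact h1

theorem lpMul_adjoint {a b : ℝ} {B : ℝ → V →L[ℂ] V} (hB : ContinuousOn B (Icc a b))
    (hB' : ContinuousOn (fun η => (B η).adjoint) (Icc a b)) :
    (lpMul hB).adjoint = lpMul hB' := by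
  symm
  rw [ContinuousLinearMap.eq_adjoint_iff]
  intro u v
  rw [L2.inner_def, L2.inner_def]
  refine integral_congr_ae ?_
  filter_upwards [coeFn_lpMul hB v, coeFn_lpMul hB' u] with η h1 h2
  rw [h1, h2, ContinuousLinearMap.adjoint_inner_left]

/-- Testing on functions `1_I v` with `I` a short interval around `η₀` shows that lower bounds pass
from the multiplication operator to the values of the multiplier. -/
theorem bddBelow_of_lpMul {a b : ℝ} (hab : a < b) {B : ℝ → V →L[ℂ] V}
    (hB : ContinuousOn B (Icc a b)) {c : ℝ} (hc : ∀ u, c * ‖u‖ ≤ ‖lpMul hB u‖)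
    {η₀ : ℝ} (hη₀ : η₀ ∈ Icc a b) (v : V) : c * ‖v‖ ≤ ‖B η₀ v‖ := by
  by_contra! hlt
  obtain ⟨r, hr1, hr2⟩ := exists_between hlt
  have hv : 0 < ‖v‖ := by
    rcases (norm_nonneg v).eq_or_lt with h | h
    · rw [← h, mul_zero] at hlt
      exact absurd hlt (not_lt.2 (norm_nonneg _))
    · exact h
  have hcont : ContinuousWithinAt (fun η => ‖B η v‖) (Icc a b) η₀ :=
    ((hB η₀ hη₀).clm_apply continuousWithinAt_const).norm
  obtain ⟨δ, hδ, hball⟩ := Metric.mem_nhdsWithin_iff.1 (hcont.eventually (gt_mem_nhds hr1))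
  set I := Metric.ball η₀ δ ∩ Icc a b with hI
  have hIm : MeasurableSet I := measurableSet_ball.inter measurableSet_Icc
  have hIfin : volume.restrict (Icc a b) I ≠ ∞ := by finiteness
  have hIpos : volume.restrict (Icc a b) I ≠ 0 := by
    rw [Measure.restrict_apply hIm, inter_assoc, inter_self]
    have hne : (Metric.ball η₀ δ ∩ Ioo a b).Nonempty := by
      rw [← closure_Ioo hab.ne] at hη₀
      exact mem_closure_iff.1 hη₀ _ Metric.isOpen_ball (Metric.mem_ball_self hδ)
    exact ((Metric.isOpen_ball.inter isOpen_Ioo).measure_pos _ hne).trans_le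
      (measure_mono (inter_subset_inter_right _ Ioo_subset_Icc_self)) |>.ne'
  set f := indicatorConstLp 2 hIm hIfin v with hf
  have h1 : ‖lpMul hB f‖ ≤ r / ‖v‖ * ‖f‖ := by
    refine Lp.norm_le_mul_norm_of_ae_le_mul ?_
    filter_upwards [coeFn_lpMul hB f,
      indicatorConstLp_coeFn (p := 2) (hs := hIm) (hμs := hIfin) (c := v)] with η e1 e2
    rw [e1, hf, e2]
    by_cases hη : η ∈ I
    · rw [indicator_of_mem hη, div_mul_cancel₀ _ hv.ne']
      exact (hball hη).le
    · simp [indicator_of_notMem hη]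
  have h2 : 0 < ‖f‖ := by
    rw [hf, norm_indicatorConstLp (by norm_num) (by norm_num)]
    have : 0 < (volume.restrict (Icc a b)).real I := ENNReal.toReal_pos hIpos hIfin
    positivity
  have h3 := le_of_mul_le_mul_right ((hc f).trans h1) h2
  rw [le_div_iff₀ hv] at h3
  linarith

/-- The pointwise inverse of a continuous family of invertible operators is again continuous, so it
defines a bounded multiplication operator. -/
theorem isUnit_lpMul_iff {a b : ℝ} (hab : a < b) {B : ℝ → V →L[ℂ] V}
    (hB : ContinuousOn B (Icc a b)) :
    IsUnit (lpMul hB) ↔ ∀ η ∈ Icc a b, IsUnit (B η) := by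
  constructor
  · intro h η hη
    have hB' : ContinuousOn (fun η => (B η).adjoint) (Icc a b) :=
      ContinuousLinearMap.adjoint.continuous.comp_continuousOn hB
    rw [isUnit_iff_bddBelow, lpMul_adjoint hB hB'] at h
    obtain ⟨⟨c, hc, h⟩, d, hd, h'⟩ := h
    exact (isUnit_iff_bddBelow _).2 ⟨⟨c, hc, bddBelow_of_lpMul hab hB h hη⟩,
      d, hd, bddBelow_of_lpMul hab hB' h' hη⟩
  · intro h
    have hi : ContinuousOn (fun η => Ring.inverse (B η)) (Icc a b) := by
      intro η hη
      obtain ⟨u, hu⟩ := h η hη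
      have h1 : ContinuousAt Ring.inverse (B η) := by
        rw [← hu]
        exact NormedRing.inverse_continuousAt u
      exact h1.comp_continuousWithinAt (hB η hη)
    refine ⟨⟨lpMul hB, lpMul hi, ?_, ?_⟩, rfl⟩
    · refine ContinuousLinearMap.ext fun u => Lp.ext ?_
      filter_upwards [coeFn_lpMul hB (lpMul hi u), coeFn_lpMul hi u,
        ae_restrict_mem measurableSet_Icc] with η h1 h2 h3
      rw [mul_apply_eq_comp, h1, h2,
        ← mul_apply_eq_comp, Ring.mul_inverse_cancel _ (h η h3)]
      rfl
    · refine ContinuousLinearMap.ext fun u => Lp.ext ?_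
      filter_upwards [coeFn_lpMul hi (lpMul hB u), coeFn_lpMul hB u,
        ae_restrict_mem measurableSet_Icc] with η h1 h2 h3
      rw [mul_apply_eq_comp, h1, h2,
        ← mul_apply_eq_comp, Ring.inverse_mul_cancel _ (h η h3)]
      rfl

/-- The character `η ↦ e^{-i η m}` of the dual group. -/
def phase (η : ℝ) (m : ℤ) : ℂ := Complex.exp (-(Complex.I * η * m))

@[fun_prop]
theorem continuous_phase (m : ℤ) : Continuous fun η => phase η m := by
  unfold phase
  fun_prop

theorem norm_phase (η : ℝ) (m : ℤ) : ‖phase η m‖ = 1 := by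
  rw [phase, show -(Complex.I * η * m) = ((-(η * m) : ℝ) : ℂ) * Complex.I by push_cast; ring,
    Complex.norm_exp_ofReal_mul_I]

theorem integral_conj_phase_mul_phase (m n : ℤ) :
    ∫ η in Icc (-Real.pi) Real.pi, (starRingEnd ℂ) (phase η m) * phase η n
      = if m = n then 2 * (Real.pi : ℂ) else 0 := by
  have h1 : ∀ η : ℝ, (starRingEnd ℂ) (phase η m) * phase η n
      = Complex.exp (Complex.I * ((m : ℂ) - n) * η) := by
    intro η
    rw [phase, phase, ← Complex.exp_conj, ← Complex.exp_add]
    congr 1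
    simp only [map_neg, map_mul, Complex.conj_I, Complex.conj_ofReal, map_intCast]
    ring
  simp_rw [h1]
  rw [integral_Icc_eq_integral_Ioc, ← intervalIntegral.integral_of_le (by linarith [Real.pi_pos])]
  split_ifs with h
  · simp [h]
    ring
  · have h0 : (m : ℂ) - n ≠ 0 := by
      rw [sub_ne_zero]
      exact_mod_cast h
    rw [integral_exp_mul_complex (mul_ne_zero Complex.I_ne_zero h0), div_eq_zero_iff]
    left
    rw [sub_eq_zero, Complex.exp_eq_exp_iff_exists_int]
    exact ⟨m - n, by push_cast; ring⟩

theorem hasSum_setIntegral_of_norm_le {f : ℤ → ℝ → ℂ} {b : ℤ → ℝ} (hb : Summable b)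
    (hf : ∀ m, Continuous (f m)) (hfb : ∀ m η, ‖f m η‖ ≤ b m) (s : Set ℝ)
    [IsFiniteMeasure (volume.restrict s)] :
    HasSum (fun m => ∫ η in s, f m η) (∫ η in s, ∑' m, f m η) := by
  refine hasSum_integral_of_dominated_convergence (fun m _ => b m)
    (fun m => (hf m).aestronglyMeasurable) (fun m => Eventually.of_forall (hfb m))
    (Eventually.of_forall fun _ => hb) (integrable_const _) (Eventually.of_forall fun η => ?_)
  exact (Summable.of_norm_bounded hb fun m => hfb m η).hasSum

omit [CompleteSpace V] in
theorem norm_phase_smul (η : ℝ) (m : ℤ) (x : V) : ‖phase η m • x‖ = ‖x‖ := by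
  rw [norm_smul, norm_phase, one_mul]

/-- Polarized Parseval identity for absolutely convergent vector-valued Fourier series. -/
theorem integral_inner_fourier {x y : ℤ → V} (hx : Summable fun m => ‖x m‖)
    (hy : Summable fun m => ‖y m‖) :
    HasSum (fun m => 2 * Real.pi * inner ℂ (x m) (y m))
      (∫ η in Icc (-Real.pi) Real.pi,
        inner ℂ (∑' m, phase η m • x m) (∑' m, phase η m • y m)) := by
  set X : ℝ → V := fun η => ∑' m, phase η m • x m with hX
  have hXs : ∀ η, HasSum (fun m => phase η m • x m) (X η) := fun η =>
    (Summable.of_norm (by simpa only [norm_phase_smul] using hx)).hasSum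
  have hYs : ∀ η, HasSum (fun m => phase η m • y m) (∑' m, phase η m • y m) := fun η =>
    (Summable.of_norm (by simpa only [norm_phase_smul] using hy)).hasSum
  have hXc : Continuous X := continuous_tsum (fun m => by fun_prop) hx
    fun m η => (norm_phase_smul _ _ _).le
  have hXb : ∀ η, ‖X η‖ ≤ ∑' m, ‖x m‖ := fun η =>
    tsum_of_norm_bounded hx.hasSum fun m => (norm_phase_smul _ _ _).le
  have h1 : ∀ η, inner ℂ (X η) (∑' m, phase η m • y m)
      = ∑' m, inner ℂ (X η) (phase η m • y m) := fun η =>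
    ((innerSL ℂ (X η)).hasSum (hYs η)).tsum_eq.symm
  have h2 : ∀ n, ∫ η in Icc (-Real.pi) Real.pi, inner ℂ (X η) (phase η n • y n)
      = 2 * Real.pi * inner ℂ (x n) (y n) := by
    intro n
    have h3 : ∀ η, inner ℂ (X η) (phase η n • y n)
        = ∑' m, inner ℂ (phase η m • x m) (phase η n • y n) := fun η => by
      have := ((innerSL ℂ (phase η n • y n)).hasSum (hXs η)).star
      simp only [innerSL_apply_apply] at this
      rw [← inner_conj_symm]
      refine (this.tsum_eq.symm.trans (tsum_congr fun m => ?_))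
      exact inner_conj_symm _ _
    simp_rw [h3]
    have h4 := hasSum_setIntegral_of_norm_le (s := Icc (-Real.pi) Real.pi)
      (f := fun m η => inner ℂ (phase η m • x m) (phase η n • y n))
      (hx.mul_right ‖y n‖) (fun m => by fun_prop) (fun m η => by
        refine (norm_inner_le_norm _ _).trans ?_
        rw [norm_phase_smul, norm_phase_smul])
    refine h4.unique ?_
    have h5 : ∀ m, ∫ η in Icc (-Real.pi) Real.pi, inner ℂ (phase η m • x m) (phase η n • y n)
        = if m = n then 2 * Real.pi * inner ℂ (x n) (y n) else 0 := by
      intro m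
      simp_rw [inner_smul_left, inner_smul_right, ← mul_assoc]
      rw [integral_mul_const, integral_conj_phase_mul_phase]
      split_ifs with h
      · rw [h]
      · simp
    simp_rw [h5]
    exact hasSum_ite_eq n _
  change HasSum _ (∫ η in Icc (-Real.pi) Real.pi, inner ℂ (X η) (∑' m, phase η m • y m))
  simp_rw [h1, ← h2]
  refine hasSum_setIntegral_of_norm_le (b := fun m => (∑' m, ‖x m‖) * ‖y m‖) (hy.mul_left _)
    (fun m => by fun_prop) (fun m η => ?_) _
  refine (norm_inner_le_norm _ _).trans ?_
  rw [norm_phase_smul]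
  exact mul_le_mul_of_nonneg_right (hXb η) (norm_nonneg _)

end VectorValued

/-! ### Operators decomposed by a Floquet transform -/

section AbstractFloquet

variable {A H V : Type*} [NormedAddCommGroup A] [InnerProductSpace ℂ A]
  [NormedAddCommGroup H] [InnerProductSpace ℂ H] [CompleteSpace H]
  [NormedAddCommGroup V] [InnerProductSpace ℂ V] [CompleteSpace V]

/-- The operator `E* L E`, that is, the form `⟨L E u, E v⟩`, for an embedding `E`. -/
def formPullback (E : V →L[ℂ] H) (L : H →L[ℂ] H) : V →L[ℂ] V := E.adjoint ∘L L ∘L E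

theorem inner_formPullback (E : V →L[ℂ] H) (L : H →L[ℂ] H) (u v : V) :
    inner ℂ v (formPullback E L u) = inner ℂ (E v) (L (E u)) :=
  ContinuousLinearMap.adjoint_inner_right E v (L (E u))

theorem continuous_formPullback {E : ℝ → V →L[ℂ] H} (hE : Continuous E) (L : H →L[ℂ] H) :
    Continuous fun η => formPullback (E η) L :=
  (ContinuousLinearMap.adjoint.continuous.comp hE).clm_comp (continuous_const.clm_comp hE)

theorem summable_phase_smul {x : ℤ → H} (hx : Summable fun m => ‖x m‖) (η : ℝ) :
    Summable fun m => phase η m • x m :=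
  Summable.of_norm (by simpa only [norm_phase_smul] using hx)

/-- The Fourier series `∑ₘ e^{-i η m} T m f` with linear coefficients. -/
def fourierSum {T : ℤ → A →ₗ[ℂ] H} (hT : ∀ f, Summable fun m => ‖T m f‖) (η : ℝ) : A →ₗ[ℂ] H where
  toFun f := ∑' m, phase η m • T m f
  map_add' f g := by
    rw [← (summable_phase_smul (hT f) η).tsum_add (summable_phase_smul (hT g) η)]
    simp_rw [map_add, smul_add]
  map_smul' c f := by
    rw [RingHom.id_apply, ← (summable_phase_smul (hT f) η).tsum_const_smul]
    simp_rw [map_smul, smul_comm c]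

theorem continuous_fourierSum {T : ℤ → A →ₗ[ℂ] H} (hT : ∀ f, Summable fun m => ‖T m f‖) (f : A) :
    Continuous fun η => fourierSum hT η f :=
  continuous_tsum (fun m => (continuous_phase m).smul continuous_const) (hT f)
    fun m η => (norm_phase_smul η m (T m f)).le

variable {D : ℝ → A →ₗ[ℂ] V} (hD : ∀ f, Continuous fun η => D η f)

omit [CompleteSpace V] in
include hD in
theorem memLp_of_continuous (f : A) :
    MemLp (fun η => D η f) 2 (volume.restrict (Icc (-Real.pi) Real.pi)) :=
  (memLp_top_of_continuousOn (hD f).continuousOn).mono_exponent le_top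

/-- A continuous family of linear maps on `[-π, π]` as a linear map into `L²([-π, π]; V)`. -/
def familyToLp : A →ₗ[ℂ] Lp V 2 (volume.restrict (Icc (-Real.pi) Real.pi)) where
  toFun f := (memLp_of_continuous hD f).toLp
  map_add' f g := by
    rw [← MemLp.toLp_add]
    exact MemLp.toLp_congr _ _ (Eventually.of_forall fun η => map_add _ _ _)
  map_smul' c f := by
    rw [RingHom.id_apply, ← MemLp.toLp_const_smul]
    exact MemLp.toLp_congr _ _ (Eventually.of_forall fun η => map_smul _ _ _)

omit [CompleteSpace V] in
theorem coeFn_familyToLp (f : A) :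
    familyToLp hD f =ᵐ[volume.restrict (Icc (-Real.pi) Real.pi)] fun η => D η f :=
  (memLp_of_continuous hD f).coeFn_toLp

/-- Pairing a function with all `χ v`, where `χ` is a test function and `v` runs through a dense
set, determines it. -/
theorem denseRange_familyToLp {S : Set V} (hS : Dense S)
    (h : ∀ v ∈ S, ∀ χ : ℝ → ℝ, ContDiff ℝ (⊤ : ℕ∞) χ → tsupport χ ⊆ Ioo (-Real.pi) Real.pi →
      ∃ f, ∀ᵐ η ∂volume.restrict (Icc (-Real.pi) Real.pi), D η f = (χ η : ℂ) • v) :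
    DenseRange (familyToLp hD) := by
  have key : (familyToLp hD).range.topologicalClosure = ⊤ := by
    rw [Submodule.topologicalClosure_eq_top_iff, Submodule.eq_bot_iff]
    intro u hu
    have hint : IntegrableOn u (Icc (-Real.pi) Real.pi) :=
      memLp_one_iff_integrable.1 ((Lp.memLp u).mono_exponent one_le_two)
    have hloc : LocallyIntegrableOn u (Ioo (-Real.pi) Real.pi) :=
      (hint.mono_set Ioo_subset_Icc_self).locallyIntegrableOn
    have h0 := isOpen_Ioo.ae_eq_zero_of_integral_contDiff_smul_eq_zero hloc
      fun χ hχ hχc hχs => by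
        have hsub : ∀ η ∉ Icc (-Real.pi) Real.pi, χ η • u η = 0 := fun η hη => by
          rw [image_eq_zero_of_notMem_tsupport fun h' => hη (Ioo_subset_Icc_self (hχs h')),
            zero_smul]
        rw [← setIntegral_eq_integral_of_forall_compl_eq_zero hsub]
        have hχint : IntegrableOn (fun η => χ η • u η) (Icc (-Real.pi) Real.pi) :=
          hint.continuousOn_smul hχ.continuous.continuousOn isCompact_Icc
        -- the integral is orthogonal to the dense set `S`
        refine hS.eq_zero_of_inner_right ℂ fun v hv => ?_
        obtain ⟨f, hf⟩ := h v hv χ hχ hχs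
        have h1 : inner ℂ (familyToLp hD f) u = 0 := hu _ ⟨f, rfl⟩
        rw [L2.inner_def] at h1
        rw [← integral_inner hχint, ← h1]
        refine integral_congr_ae ?_
        filter_upwards [coeFn_familyToLp hD f, hf] with η e1 e2
        rw [e1, e2, inner_smul_left, Complex.conj_ofReal, ← Complex.coe_smul, inner_smul_right]
    refine Lp.ext ?_
    have h1 : ∀ᵐ η ∂volume.restrict (Icc (-Real.pi) Real.pi), u η = 0 := by
      rw [ae_restrict_iff' measurableSet_Icc]
      filter_upwards [h0, Ioo_ae_eq_Icc.mem_iff] with η e1 e2 e3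
      exact e1 (e2.2 e3)
    filter_upwards [h1, Lp.coeFn_zero V 2 (volume.restrict (Icc (-Real.pi) Real.pi))] with η e1 e2
    rw [e1, e2, Pi.zero_apply]
  exact Submodule.dense_iff_topologicalClosure_eq_top.2 key

variable {E : ℝ → V →L[ℂ] H} (hE : Continuous E) {T : ℤ → A →ₗ[ℂ] H}
  (hT : ∀ f, Summable fun m => ‖T m f‖)
  (hED : ∀ η f, E η (D η f) = fourierSum hT η f)

include hED in
/-- The transform turns an operator acting on each coefficient separately into multiplication. -/
theorem hasSum_inner_coeff (L : H →L[ℂ] H) (f g : A) :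
    HasSum (fun m => 2 * Real.pi * inner ℂ (T m g) (L (T m f)))
      (inner ℂ (familyToLp hD g)
        (lpMul (continuous_formPullback hE L).continuousOn (familyToLp hD f))) := by
  have h1 : inner ℂ (familyToLp hD g)
        (lpMul (continuous_formPullback hE L).continuousOn (familyToLp hD f))
      = ∫ η in Icc (-Real.pi) Real.pi, inner ℂ (∑' m, phase η m • T m g)
        (∑' m, phase η m • L (T m f)) := by
    rw [L2.inner_def]
    refine integral_congr_ae ?_
    filter_upwards [coeFn_familyToLp hD f, coeFn_familyToLp hD g,
      coeFn_lpMul (continuous_formPullback hE L).continuousOn (familyToLp hD f)] with η e1 e2 e3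
    have h2 : L (∑' m, phase η m • T m f) = ∑' m, phase η m • L (T m f) := by
      rw [L.map_tsum (summable_phase_smul (hT f) η)]
      simp_rw [map_smul]
    rw [e3, e1, e2, inner_formPullback, hED, hED, ← h2]
    rfl
  rw [h1]
  exact integral_inner_fourier (hT g) (Summable.of_nonneg_of_le (fun _ => norm_nonneg _)
    (fun m => L.le_opNorm _) ((hT f).mul_left _))

include hE hED in
/-- An operator on `A` whose form is, after a change of variables `W` with dense range, the sum of
the forms of `L` on the Fourier coefficients `T m f` is invertible if and only if all the fibers of
`L` are. -/
theorem isUnit_iff_forall_fiber [CompleteSpace A] {W : A → A} (hW : DenseRange W)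
    (hDr : DenseRange (familyToLp hD))
    (hWT : ∀ f g, HasSum (fun m => inner ℂ (T m g) (T m f)) (inner ℂ (W g) (W f)))
    {c : ℝ} (hEc : ∀ η ∈ Icc (-Real.pi) Real.pi, ∀ v, ‖v‖ ≤ c * ‖E η v‖)
    {R : A →L[ℂ] A} {L : H →L[ℂ] H}
    (hR : ∀ f g, HasSum (fun m => inner ℂ (T m g) (L (T m f))) (inner ℂ (W g) (R (W f)))) :
    IsUnit R ↔ ∀ η ∈ Icc (-Real.pi) Real.pi, IsUnit (formPullback (E η) L) := by
  have hpi := Real.two_pi_pos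
  have hpi0 : (2 * Real.pi : ℂ) ≠ 0 := by exact_mod_cast hpi.ne'
  have hpars : ∀ f, inner ℂ (familyToLp hD f) (lpMul (continuous_formPullback hE
      (ContinuousLinearMap.id ℂ H)).continuousOn (familyToLp hD f))
      = ((2 * Real.pi * ‖W f‖ ^ 2 : ℝ) : ℂ) := fun f => by
    rw [(hasSum_inner_coeff hD hE hT hED (ContinuousLinearMap.id ℂ H) f f).unique
      ((hWT f f).mul_left _), inner_self_eq_norm_sq_to_K]
    push_cast
    rfl
  set B := lpMul (continuous_formPullback hE (ContinuousLinearMap.id ℂ H)).continuousOn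
    (a := -Real.pi) (b := Real.pi) with hB
  rw [← isUnit_lpMul_iff (by linarith) (continuous_formPullback hE L).continuousOn]
  refine isUnit_iff_of_pairing (N := W) (G := familyToLp hD) hW hDr (k := (2 * Real.pi : ℂ)⁻¹)
    (inv_ne_zero hpi0) (C := Real.sqrt ‖B‖) (D := |c| * Real.sqrt (2 * Real.pi))
    (fun f => ?_) (fun f => ?_) fun f g => ?_
  · have h1 : 2 * Real.pi * ‖W f‖ ^ 2 ≤ ‖B‖ * ‖familyToLp hD f‖ ^ 2 := by
      have h2 := norm_inner_le_norm (𝕜 := ℂ) (familyToLp hD f) (B (familyToLp hD f))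
      rw [hpars, Complex.norm_real, Real.norm_of_nonneg (by positivity)] at h2
      nlinarith [B.le_opNorm (familyToLp hD f), norm_nonneg (familyToLp hD f)]
    refine abs_le_of_sq_le_sq' ?_ (by positivity) |>.2
    rw [mul_pow, Real.sq_sqrt (norm_nonneg _)]
    nlinarith [Real.two_le_pi, sq_nonneg ‖W f‖]
  · set u := familyToLp hD f
    have h1 : ‖u‖ ^ 2 = RCLike.re (∫ η in Icc (-Real.pi) Real.pi, inner ℂ (u η) (u η)) := by
      rw [← L2.inner_def, inner_self_eq_norm_sq (𝕜 := ℂ) u]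
    have h2 : 2 * Real.pi * ‖W f‖ ^ 2
        = RCLike.re (∫ η in Icc (-Real.pi) Real.pi, inner ℂ (u η) (B u η)) := by
      rw [← L2.inner_def, hpars]
      rfl
    have hi1 := L2.integrable_inner (𝕜 := ℂ) u u
    have hi2 := L2.integrable_inner (𝕜 := ℂ) u (B u)
    rw [← integral_re hi1] at h1
    rw [← integral_re hi2] at h2
    have h3 : ‖u‖ ^ 2 ≤ |c| ^ 2 * (2 * Real.pi * ‖W f‖ ^ 2) := by
      rw [h1, h2, ← integral_const_mul]
      refine integral_mono_ae hi1.re (hi2.re.const_mul _) ?_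
      filter_upwards [coeFn_lpMul (continuous_formPullback hE
        (ContinuousLinearMap.id ℂ H)).continuousOn u,
        ae_restrict_mem measurableSet_Icc] with η e1 e2
      change RCLike.re (inner ℂ (u η) (u η)) ≤ |c| ^ 2 * RCLike.re (inner ℂ (u η) (B u η))
      rw [e1, inner_formPullback, ContinuousLinearMap.id_apply, inner_self_eq_norm_sq,
        inner_self_eq_norm_sq, ← mul_pow]
      exact pow_le_pow_left₀ (norm_nonneg _) ((hEc η e2 (u η)).trans
        (mul_le_mul_of_nonneg_right (le_abs_self c) (norm_nonneg _))) 2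
    refine abs_le_of_sq_le_sq' (h3.trans (le_of_eq ?_)) (by positivity) |>.2
    rw [mul_pow, mul_pow, Real.sq_sqrt (by positivity)]
    ring
  · rw [(hasSum_inner_coeff hD hE hT hED L f g).unique ((hR f g).mul_left _),
      inv_mul_cancel_left₀ hpi0]

end AbstractFloquet

/-! ### Multiplication operators and compressions -/

section Multipliers

variable {Ω : Set ℂ}

/-- Multiplication by `a - c` on `L²(Ω)`, written as `M_a - c`. -/
def mulSubConst {a : ℂ → ℂ} (ha : MemLp a ∞ (volume.restrict Ω)) (c : ℂ) :
    Lp ℂ 2 (volume.restrict Ω) →L[ℂ] Lp ℂ 2 (volume.restrict Ω) :=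
  mulOperator ha - c • ContinuousLinearMap.id ℂ (Lp ℂ 2 (volume.restrict Ω))

theorem coeFn_mulSubConst {a : ℂ → ℂ} (ha : MemLp a ∞ (volume.restrict Ω)) (c : ℂ)
    (f : Lp ℂ 2 (volume.restrict Ω)) :
    mulSubConst ha c f =ᵐ[volume.restrict Ω] fun z => (a z - c) * f z := by
  filter_upwards [coeFn_mulOperator ha f, Lp.coeFn_sub (mulOperator ha f) (c • f),
    Lp.coeFn_smul c f] with z h1 h2 h3
  change (mulOperator ha f - c • f : Lp ℂ 2 (volume.restrict Ω)) z = _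
  rw [h2, Pi.sub_apply, h1, h3, Pi.smul_apply, smul_eq_mul]
  ring

/-- The projection disappears from the form of a Toeplitz operator. -/
theorem inner_toeplitzOn (A : Submodule ℂ (Lp ℂ 2 (volume.restrict Ω)))
    [A.HasOrthogonalProjection] {a : ℂ → ℂ} (ha : MemLp a ∞ (volume.restrict Ω)) (c : ℂ)
    (f g : A) :
    inner ℂ g ((toeplitzOn A ha - c • ContinuousLinearMap.id ℂ A) f)
      = inner ℂ (g : Lp ℂ 2 (volume.restrict Ω)) (mulSubConst ha c f) := by
  have h : (toeplitzOn A ha - c • ContinuousLinearMap.id ℂ A) f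
      = A.orthogonalProjectionOnto (mulOperator ha f) - c • f := rfl
  have h' : mulSubConst ha c f = mulOperator ha f - c • (f : Lp ℂ 2 (volume.restrict Ω)) := rfl
  have h3 : inner ℂ g (c • f) = inner ℂ (g : Lp ℂ 2 (volume.restrict Ω))
      (c • (f : Lp ℂ 2 (volume.restrict Ω))) := rfl
  rw [h, h', inner_sub_right, inner_sub_right, h3,
    Submodule.inner_orthogonalProjectionOnto_eq_of_mem_left]

theorem mem_spectrum_iff_not_isUnit_sub {H : Type*} [NormedAddCommGroup H] [InnerProductSpace ℂ H]
    (T : H →L[ℂ] H) (c : ℂ) :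
    c ∈ spectrum ℂ T ↔ ¬ IsUnit (T - c • ContinuousLinearMap.id ℂ H) := by
  rw [spectrum.mem_iff, ← IsUnit.neg_iff, neg_sub]
  rfl

end Multipliers

/-! ### Geometry of the periodic domain -/

theorem volume_graph_eq_zero {φ : ℝ → ℝ} (hφ : Continuous φ) :
    volume {w : ℂ | w.im = φ w.re} = 0 := by
  have h1 : MeasurableSet {p : ℝ × ℝ | p.2 = φ p.1} :=
    measurableSet_eq_fun measurable_snd (hφ.measurable.comp measurable_fst)
  have h2 : volume {p : ℝ × ℝ | p.2 = φ p.1} = 0 := by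
    rw [Measure.volume_eq_prod, Measure.measure_prod_null h1]
    refine Eventually.of_forall fun x => ?_
    have : Prod.mk x ⁻¹' {p : ℝ × ℝ | p.2 = φ p.1} = {φ x} := by ext y; simp
    simp [this]
  rw [← Complex.volume_preserving_equiv_real_prod.measure_preimage h1.nullMeasurableSet] at h2
  exact h2

/-- A Lipschitz boundary is a null set, being locally contained in a rotated Lipschitz graph. -/
theorem HasLipschitzBoundary.volume_frontier {Ω : Set ℂ} (hΩ : HasLipschitzBoundary Ω)
    (ho : IsOpen Ω) : volume (frontier Ω) = 0 := by
  refine measure_null_of_locally_null _ fun p hp => ?_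
  obtain ⟨u, r, K, φ, hr, hφ, h⟩ := hΩ p hp
  refine ⟨frontier Ω ∩ Metric.ball p r, inter_mem self_mem_nhdsWithin
    (mem_nhdsWithin_of_mem_nhds (Metric.ball_mem_nhds p hr)), ?_⟩
  have hmp : MeasurePreserving (fun z : ℂ => (u : ℂ) * (z - p)) volume volume :=
    ((rotation u).measurePreserving).comp (measurePreserving_sub_right volume p)
  have hcont : Continuous fun z : ℂ => (u : ℂ) * (z - p) := by fun_prop
  have hφc := hφ.continuous
  have hnull : volume ((fun z : ℂ => (u : ℂ) * (z - p)) ⁻¹' {w : ℂ | w.im = φ w.re}) = 0 := by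
    rw [hmp.measure_preimage, volume_graph_eq_zero hφc]
    exact (measurableSet_eq_fun Complex.measurable_im
      (hφc.measurable.comp Complex.measurable_re)).nullMeasurableSet
  refine measure_mono_null (fun z hz => ?_) hnull
  change ((u : ℂ) * (z - p)).im = φ ((u : ℂ) * (z - p)).re
  rcases lt_trichotomy (φ ((u : ℂ) * (z - p)).re) ((u : ℂ) * (z - p)).im with hlt | heq | hgt
  · have : z ∈ Ω := (h z hz.2).2 hlt
    rw [ho.frontier_eq] at hz
    exact absurd this hz.1.2
  · exact heq.symm
  · have hU : IsOpen (Metric.ball p r ∩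
        {z : ℂ | ((u : ℂ) * (z - p)).im < φ ((u : ℂ) * (z - p)).re}) :=
      Metric.isOpen_ball.inter (isOpen_lt (by fun_prop) (by fun_prop))
    obtain ⟨w, hw, hwΩ⟩ := mem_closure_iff.1 (frontier_subset_closure hz.1) _ hU ⟨hz.2, hgt⟩
    exact absurd ((h w hw.1).1 hwΩ) (not_lt.2 hw.2.le)

namespace PeriodicCell

variable (C : PeriodicCell)

theorem re_mem {z : ℂ} (hz : z ∈ C.carrier) : z.re ∈ Ioo (0 : ℝ) 1 := by
  obtain ⟨M, -, h⟩ := C.subset_strip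
  exact (Complex.mem_reProdIm.1 (h hz)).1

theorem closure_translate (m : ℤ) :
    closure ((fun z : ℂ => z + m) '' (C.carrier : Set ℂ))
      = {z : ℂ | z - m ∈ closure (C.carrier : Set ℂ)} := by
  have := (Homeomorph.addRight (m : ℂ)).image_closure (C.carrier : Set ℂ)
  rw [Homeomorph.coe_addRight] at this
  rw [← this]
  ext z
  constructor
  · rintro ⟨w, hw, rfl⟩
    simpa using hw
  · intro hz
    exact ⟨z - m, hz, by simp⟩

theorem exists_of_mem_domain {z : ℂ} (hz : z ∈ C.domain) :
    ∃ m : ℤ, z - m ∈ closure (C.carrier : Set ℂ) := by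
  have := interior_subset hz
  simpa only [closure_translate, mem_iUnion] using! this

theorem add_intCast_mem_domain_iff (m : ℤ) {z : ℂ} :
    z + m ∈ C.domain ↔ z ∈ C.domain := by
  have key : ∀ (k : ℤ) (w : ℂ), w ∈ C.domain → w + k ∈ C.domain := by
    intro k w hw
    have hopen : IsOpen ((fun z : ℂ => z - k) ⁻¹' (C.domain : Set ℂ)) :=
      C.domain.isOpen.preimage (by fun_prop)
    refine interior_maximal (fun z hz => ?_) hopen (show w + k - k ∈ C.domain by simpa using hw)
    obtain ⟨m, hm⟩ := C.exists_of_mem_domain hz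
    rw [mem_iUnion]
    refine ⟨m + k, ?_⟩
    rw [closure_translate]
    change z - ((m + k : ℤ) : ℂ) ∈ closure (C.carrier : Set ℂ)
    convert hm using 1
    push_cast
    ring
  refine ⟨fun h => ?_, key m z⟩
  have := key (-m) _ h
  simpa using this

theorem add_one_mem_domain_iff {z : ℂ} : z + 1 ∈ C.domain ↔ z ∈ C.domain := by
  simpa using C.add_intCast_mem_domain_iff 1 (z := z)

/-- The translate `ϖ + m` of the cell. -/
def cell (m : ℤ) : Set ℂ := (fun z : ℂ => z + (-m : ℤ)) ⁻¹' (C.carrier : Set ℂ)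

theorem isOpen_cell (m : ℤ) : IsOpen (C.cell m) := C.carrier.isOpen.preimage (by fun_prop)

theorem cell_subset_domain (m : ℤ) : C.cell m ⊆ C.domain := fun _ hz =>
  (C.add_intCast_mem_domain_iff (-m)).1 (C.carrier_subset_domain hz)

theorem floor_re_of_mem_cell {m : ℤ} {z : ℂ} (hz : z ∈ C.cell m) : ⌊z.re⌋ = m := by
  have := C.re_mem hz
  simp only [Complex.add_re, Complex.intCast_re, mem_Ioo] at this
  push_cast at this
  rw [Int.floor_eq_iff]
  constructor <;> linarith

theorem pairwise_disjoint_cell : Pairwise (Function.onFun Disjoint C.cell) := by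
  intro m n hmn
  rw [Function.onFun, Set.disjoint_left]
  intro z hm hn
  exact hmn ((C.floor_re_of_mem_cell hm).symm.trans (C.floor_re_of_mem_cell hn))

theorem domain_ae_eq_iUnion_cell :
    (⋃ m, C.cell m : Set ℂ) =ᵐ[volume] (C.domain : Set ℂ) := by
  refine (LE.le.eventuallyLE (iUnion_subset C.cell_subset_domain)).antisymm ?_
  rw [ae_le_set]
  refine measure_mono_null (t := ⋃ m : ℤ, (fun z : ℂ => z - m) ⁻¹' frontier (C.carrier : Set ℂ))
    ?_ (measure_iUnion_null fun m => ?_)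
  · rintro z ⟨hz, hz'⟩
    obtain ⟨m, hm⟩ := C.exists_of_mem_domain hz
    refine mem_iUnion.2 ⟨m, ?_⟩
    rw [mem_preimage, C.carrier.isOpen.frontier_eq]
    refine ⟨hm, fun h => hz' (mem_iUnion.2 ⟨m, ?_⟩)⟩
    rw [cell, mem_preimage]
    simpa [sub_eq_add_neg] using! h
  · rw [(measurePreserving_sub_right volume (m : ℂ)).measure_preimage
      isClosed_frontier.measurableSet.nullMeasurableSet]
    exact C.lipschitz.volume_frontier C.carrier.isOpen

theorem restrict_domain :
    volume.restrict (C.domain : Set ℂ) = volume.restrict (⋃ m, C.cell m) :=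
  (Measure.restrict_congr_set C.domain_ae_eq_iUnion_cell).symm

theorem measurePreserving_translate_cell (m : ℤ) :
    MeasurePreserving (fun z : ℂ => z + m) (volume.restrict (C.carrier : Set ℂ))
      (volume.restrict (C.cell m)) := by
  have h := (measurePreserving_add_right volume (m : ℂ)).restrict_preimage
    (C.isOpen_cell m).measurableSet
  have h2 : (fun z : ℂ => z + m) ⁻¹' C.cell m = C.carrier := by
    ext z
    simp [cell]
  rwa [h2] at h

theorem measurePreserving_translate_domain (m : ℤ) :
    MeasurePreserving (fun z : ℂ => z + m) (volume.restrict (C.domain : Set ℂ))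
      (volume.restrict (C.domain : Set ℂ)) := by
  have h := (measurePreserving_add_right volume (m : ℂ)).restrict_preimage
    C.domain.isOpen.measurableSet
  have h2 : (fun z : ℂ => z + m) ⁻¹' (C.domain : Set ℂ) = C.domain := by
    ext z
    exact C.add_intCast_mem_domain_iff m
  rwa [h2] at h

theorem quasiMeasurePreserving_translate (m : ℤ) :
    Measure.QuasiMeasurePreserving (fun z : ℂ => z + m) (volume.restrict (C.carrier : Set ℂ))
      (volume.restrict (C.domain : Set ℂ)) :=
  (C.measurePreserving_translate_cell m).quasiMeasurePreserving.mono_right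
    (Measure.absolutelyContinuous_of_le (Measure.restrict_mono (C.cell_subset_domain m) le_rfl))

/-! ### Decomposition of `L²(Π)` into cells -/

theorem memLp_translate (m : ℤ) {f : ℂ → ℂ} (hf : MemLp f 2 (volume.restrict (C.domain : Set ℂ))) :
    MemLp (fun z => f (z + m)) 2 (volume.restrict (C.carrier : Set ℂ)) :=
  (hf.mono_measure (Measure.restrict_mono (C.cell_subset_domain m) le_rfl)).comp_measurePreserving
    (C.measurePreserving_translate_cell m)

theorem coeFn_toLp_translate (m : ℤ) (f : Lp ℂ 2 (volume.restrict (C.domain : Set ℂ))) :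
    (C.memLp_translate m (Lp.memLp f)).toLp
      =ᵐ[volume.restrict (C.carrier : Set ℂ)] fun z => f (z + m) :=
  MemLp.coeFn_toLp _

/-- The restriction of `f ∈ L²(Π)` to `ϖ + m`, moved to `ϖ`. -/
def cellRestrict (m : ℤ) : Lp ℂ 2 (volume.restrict (C.domain : Set ℂ)) →L[ℂ]
    Lp ℂ 2 (volume.restrict (C.carrier : Set ℂ)) :=
  LinearMap.mkContinuous
    { toFun := fun f => (C.memLp_translate m (Lp.memLp f)).toLp
      map_add' := fun f g => by
        refine Lp.ext ?_
        filter_upwards [C.coeFn_toLp_translate m (f + g), C.coeFn_toLp_translate m f,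
          C.coeFn_toLp_translate m g, Lp.coeFn_add (C.memLp_translate m (Lp.memLp f)).toLp
            (C.memLp_translate m (Lp.memLp g)).toLp,
          (C.quasiMeasurePreserving_translate m).ae (Lp.coeFn_add f g)] with z h1 h2 h3 h4 h5
        rw [h1, h4, Pi.add_apply, h2, h3, h5, Pi.add_apply]
      map_smul' := fun c f => by
        refine Lp.ext ?_
        filter_upwards [C.coeFn_toLp_translate m (c • f), C.coeFn_toLp_translate m f,
          Lp.coeFn_smul c (C.memLp_translate m (Lp.memLp f)).toLp,
          (C.quasiMeasurePreserving_translate m).ae (Lp.coeFn_smul c f)] with z h1 h2 h4 h5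
        rw [h1, RingHom.id_apply, h4, Pi.smul_apply, h2, h5, Pi.smul_apply] } 1 fun f => by
    rw [one_mul]
    change ‖(C.memLp_translate m (Lp.memLp f)).toLp‖ ≤ _
    rw [Lp.norm_toLp, Lp.norm_def]
    refine ENNReal.toReal_mono (Lp.eLpNorm_ne_top f) ?_
    have h := eLpNorm_comp_measurePreserving (p := 2) (((Lp.memLp f).mono_measure
      (Measure.restrict_mono (C.cell_subset_domain m) le_rfl)).1)
      (C.measurePreserving_translate_cell m)
    exact h.trans_le
      (eLpNorm_mono_measure _ (Measure.restrict_mono (C.cell_subset_domain m) le_rfl))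

theorem coeFn_cellRestrict (m : ℤ) (f : Lp ℂ 2 (volume.restrict (C.domain : Set ℂ))) :
    C.cellRestrict m f =ᵐ[volume.restrict (C.carrier : Set ℂ)] fun z => f (z + m) :=
  C.coeFn_toLp_translate m f

theorem norm_cellRestrict_le (m : ℤ) (f : Lp ℂ 2 (volume.restrict (C.domain : Set ℂ))) :
    ‖C.cellRestrict m f‖ ≤ ‖f‖ := by
  have := (C.cellRestrict m).le_of_opNorm_le (LinearMap.mkContinuous_norm_le _ zero_le_one _) f
  rwa [one_mul] at this

theorem hasSum_inner_cellRestrict (f g : Lp ℂ 2 (volume.restrict (C.domain : Set ℂ))) :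
    HasSum (fun m => inner ℂ (C.cellRestrict m f) (C.cellRestrict m g)) (inner ℂ f g) := by
  have h1 := L2.integrable_inner (𝕜 := ℂ) f g
  have h2 : ∀ m, inner ℂ (C.cellRestrict m f) (C.cellRestrict m g)
      = ∫ z in C.cell m, inner ℂ (f z) (g z) := by
    intro m
    rw [L2.inner_def, ← (C.measurePreserving_translate_cell m).integral_comp
      (MeasurableEquiv.addRight (m : ℂ)).measurableEmbedding]
    refine integral_congr_ae ?_
    filter_upwards [C.coeFn_cellRestrict m f, C.coeFn_cellRestrict m g] with z e1 e2
    rw [e1, e2]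
  simp_rw [h2]
  rw [L2.inner_def]
  simp_rw [C.restrict_domain] at h1 ⊢
  exact hasSum_integral_iUnion (fun m => (C.isOpen_cell m).measurableSet)
    C.pairwise_disjoint_cell h1

theorem hasSum_norm_sq_cellRestrict (f : Lp ℂ 2 (volume.restrict (C.domain : Set ℂ))) :
    HasSum (fun m => ‖C.cellRestrict m f‖ ^ 2) (‖f‖ ^ 2) := by
  have h := C.hasSum_inner_cellRestrict f f
  simp_rw [inner_self_eq_norm_sq_to_K] at h
  exact_mod_cast h

/-! ### Translation invariance and the essential spectrum -/

theorem ae_periodic {a : ℂ → ℂ}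
    (hper : ∀ᵐ z ∂volume.restrict (C.domain : Set ℂ), a z = a (z + 1)) (m : ℤ) :
    ∀ᵐ z ∂volume.restrict (C.domain : Set ℂ), a (z + m) = a z := by
  induction m using Int.induction_on with
  | zero => simp
  | succ k ih =>
    filter_upwards [ih,
      (C.measurePreserving_translate_domain k).quasiMeasurePreserving.ae hper] with z h1 h2
    rw [← h1, h2]
    congr 1
    push_cast
    ring
  | pred k ih =>
    filter_upwards [ih, (C.measurePreserving_translate_domain
      (-(k : ℤ) - 1)).quasiMeasurePreserving.ae hper] with z h1 h2
    rw [h2, ← h1]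
    congr 1
    push_cast
    ring

theorem cellRestrict_mulSubConst {a : ℂ → ℂ}
    (ha : MemLp a ∞ (volume.restrict (C.domain : Set ℂ)))
    (hper : ∀ᵐ z ∂volume.restrict (C.domain : Set ℂ), a z = a (z + 1)) (c : ℂ) (m : ℤ)
    (f : Lp ℂ 2 (volume.restrict (C.domain : Set ℂ))) :
    C.cellRestrict m (mulSubConst ha c f)
      = mulSubConst (C.memLp_carrier ha) c (C.cellRestrict m f) := by
  refine Lp.ext ?_
  filter_upwards [C.coeFn_cellRestrict m (mulSubConst ha c f), C.coeFn_cellRestrict m f,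
    (C.quasiMeasurePreserving_translate m).ae (coeFn_mulSubConst ha c f),
    coeFn_mulSubConst (C.memLp_carrier ha) c (C.cellRestrict m f),
    ae_mono (Measure.restrict_mono C.carrier_subset_domain le_rfl)
      (C.ae_periodic hper m)] with z h1 h2 h3 h4 h5
  rw [h1, h3, h4, h2, h5]

/-- Translation by an integer as an isometry of `L²(Π)`. -/
def translate (m : ℤ) : Lp ℂ 2 (volume.restrict (C.domain : Set ℂ)) →ₗᵢ[ℂ]
    Lp ℂ 2 (volume.restrict (C.domain : Set ℂ)) :=
  Lp.compMeasurePreservingₗᵢ ℂ _ (C.measurePreserving_translate_domain m)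

theorem coeFn_translate (m : ℤ) (f : Lp ℂ 2 (volume.restrict (C.domain : Set ℂ))) :
    C.translate m f =ᵐ[volume.restrict (C.domain : Set ℂ)] fun z => f (z + m) :=
  Lp.coeFn_compMeasurePreserving f (C.measurePreserving_translate_domain m)

theorem translate_translate_neg (m : ℤ) (f : Lp ℂ 2 (volume.restrict (C.domain : Set ℂ))) :
    C.translate m (C.translate (-m) f) = f := by
  refine Lp.ext ?_
  filter_upwards [C.coeFn_translate m (C.translate (-m) f),
    (C.measurePreserving_translate_domain m).quasiMeasurePreserving.ae
      (C.coeFn_translate (-m) f)] with z h1 h2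
  rw [h1, h2]
  simp

theorem translate_mem_bergmanSpace (m : ℤ) {f : Lp ℂ 2 (volume.restrict (C.domain : Set ℂ))}
    (hf : f ∈ bergmanSpace C.domain) : C.translate m f ∈ bergmanSpace C.domain := by
  obtain ⟨g, hg, hfg⟩ := hf
  refine ⟨fun z => g (z + m), hg.comp (by fun_prop) fun z hz =>
    (C.add_intCast_mem_domain_iff m).2 hz, ?_⟩
  filter_upwards [C.coeFn_translate m f,
    (C.measurePreserving_translate_domain m).quasiMeasurePreserving.ae hfg] with z h1 h2
  rw [h1, h2]

theorem mulSubConst_translate {a : ℂ → ℂ}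
    (ha : MemLp a ∞ (volume.restrict (C.domain : Set ℂ)))
    (hper : ∀ᵐ z ∂volume.restrict (C.domain : Set ℂ), a z = a (z + 1)) (c : ℂ) (m : ℤ)
    (f : Lp ℂ 2 (volume.restrict (C.domain : Set ℂ))) :
    mulSubConst ha c (C.translate m f) = C.translate m (mulSubConst ha c f) := by
  refine Lp.ext ?_
  filter_upwards [C.coeFn_translate m (mulSubConst ha c f), C.coeFn_translate m f,
    (C.measurePreserving_translate_domain m).quasiMeasurePreserving.ae (coeFn_mulSubConst ha c f),
    coeFn_mulSubConst ha c (C.translate m f), C.ae_periodic hper m] with z h1 h2 h3 h4 h5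
  rw [h1, h3, h4, h2, h5]

theorem cellRestrict_translate (m n : ℤ) (f : Lp ℂ 2 (volume.restrict (C.domain : Set ℂ))) :
    C.cellRestrict n (C.translate m f) = C.cellRestrict (n + m) f := by
  refine Lp.ext ?_
  filter_upwards [C.coeFn_cellRestrict n (C.translate m f), C.coeFn_cellRestrict (n + m) f,
    (C.quasiMeasurePreserving_translate n).ae (C.coeFn_translate m f)] with z h1 h2 h3
  rw [h1, h2, h3]
  push_cast
  rw [add_assoc]

/-- The translation by `m` as a linear map of `A²(Π)` into itself. -/
def bergmanTranslateₗ (m : ℤ) : bergmanSpace C.domain →ₗ[ℂ] bergmanSpace C.domain :=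
  (C.translate m).toLinearMap.restrict fun _ hf => C.translate_mem_bergmanSpace m hf

theorem bergmanTranslateₗ_comp_neg (m : ℤ) :
    C.bergmanTranslateₗ m ∘ₗ C.bergmanTranslateₗ (-m) = LinearMap.id :=
  LinearMap.ext fun f => Subtype.ext (C.translate_translate_neg m f)

/-- The translation by `1` as a unitary operator on `A²(Π)`. -/
def bergmanTranslate : bergmanSpace C.domain ≃ₗᵢ[ℂ] bergmanSpace C.domain where
  toLinearEquiv := LinearEquiv.ofLinearMap (C.bergmanTranslateₗ 1) (C.bergmanTranslateₗ (-1))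
    (C.bergmanTranslateₗ_comp_neg 1) (by simpa using C.bergmanTranslateₗ_comp_neg (-1))
  norm_map' f := (C.translate 1).norm_map f

/-- An eigenvector of the translation would have the same norm on all the cells. -/
theorem eq_zero_of_bergmanTranslate_eq_smul (f : bergmanSpace C.domain) (μ : ℂ)
    (h : C.bergmanTranslate f = μ • f) : f = 0 := by
  by_contra hf
  have hf' : ‖f‖ ≠ 0 := norm_ne_zero_iff.2 hf
  have hμ : ‖μ‖ = 1 := by
    have h1 := congrArg norm h
    rw [LinearIsometryEquiv.norm_map, norm_smul] at h1
    exact (mul_right_cancel₀ hf' (by rw [one_mul]; exact h1)).symm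
  have hc : C.translate 1 (f : Lp ℂ 2 _) = μ • (f : Lp ℂ 2 _) := congrArg Subtype.val h
  have hstep : ∀ m : ℤ, ‖C.cellRestrict (m + 1) (f : Lp ℂ 2 _)‖
      = ‖C.cellRestrict m (f : Lp ℂ 2 _)‖ := by
    intro m
    rw [← C.cellRestrict_translate, hc, map_smul, norm_smul, hμ, one_mul]
  have hconst : ∀ m : ℤ, ‖C.cellRestrict m (f : Lp ℂ 2 _)‖
      = ‖C.cellRestrict 0 (f : Lp ℂ 2 _)‖ := by
    intro m
    induction m using Int.induction_on with
    | zero => rfl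
    | succ k ih => rw [hstep, ih]
    | pred k ih => rw [← ih, ← hstep (-(k : ℤ) - 1), sub_add_cancel]
  have hsum := C.hasSum_norm_sq_cellRestrict (f : Lp ℂ 2 _)
  simp_rw [hconst] at hsum
  have h0 := (summable_const_iff _).1 hsum.summable
  rw [h0] at hsum
  have := hsum.unique hasSum_zero
  exact hf' (pow_eq_zero_iff two_ne_zero |>.1 this)

theorem bergmanToeplitz_commute {a : ℂ → ℂ}
    (ha : MemLp a ∞ (volume.restrict (C.domain : Set ℂ)))
    (hper : ∀ᵐ z ∂volume.restrict (C.domain : Set ℂ), a z = a (z + 1)) (c : ℂ)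
    (f : bergmanSpace C.domain) :
    (bergmanToeplitz C.domain ha - c • ContinuousLinearMap.id ℂ (bergmanSpace C.domain))
      (C.bergmanTranslate f)
      = C.bergmanTranslate ((bergmanToeplitz C.domain ha -
        c • ContinuousLinearMap.id ℂ (bergmanSpace C.domain)) f) := by
  refine ext_inner_left ℂ fun y => ?_
  obtain ⟨g, rfl⟩ := C.bergmanTranslate.surjective y
  rw [LinearIsometryEquiv.inner_map_map, bergmanToeplitz, inner_toeplitzOn, inner_toeplitzOn]
  change inner ℂ (C.translate 1 (g : Lp ℂ 2 _)) (mulSubConst ha c (C.translate 1 (f : Lp ℂ 2 _)))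
    = _
  rw [C.mulSubConst_translate ha hper, LinearIsometry.inner_map_map]

theorem essentialSpectrum_eq_spectrum {a : ℂ → ℂ}
    (ha : MemLp a ∞ (volume.restrict (C.domain : Set ℂ)))
    (hper : ∀ᵐ z ∂volume.restrict (C.domain : Set ℂ), a z = a (z + 1)) :
    essentialSpectrum (bergmanToeplitz C.domain ha)
      = spectrum ℂ (bergmanToeplitz C.domain ha) := by
  ext c
  rw [mem_spectrum_iff_not_isUnit_sub]
  refine not_congr ⟨fun h => ?_, isFredholm_of_isUnit⟩
  exact isUnit_of_isFredholm_of_commute h C.bergmanTranslate (C.bergmanToeplitz_commute ha hper c)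
    C.eq_zero_of_bergmanTranslate_eq_smul

/-! ### Quasiperiodic extension to the periodic domain -/

theorem re_mem_Icc_of_mem_closure {z : ℂ} (hz : z ∈ closure (C.carrier : Set ℂ)) :
    z.re ∈ Icc (0 : ℝ) 1 := by
  have : closure (C.carrier : Set ℂ) ⊆ Complex.re ⁻¹' Icc 0 1 :=
    closure_minimal (fun w hw => Ioo_subset_Icc_self (C.re_mem hw))
      (isClosed_Icc.preimage Complex.continuous_re)
  exact this hz

/-- A point of `Π` on the imaginary axis lies on the left side of `ϖ` or on the right side of
`ϖ - 1`. -/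
theorem im_mem_Icc_of_re_eq_zero {z : ℂ} (hz : z ∈ C.domain) (hre : z.re = 0) :
    z.im ∈ Icc C.lower C.upper := by
  obtain ⟨m, hm⟩ := C.exists_of_mem_domain hz
  have h1 := C.re_mem_Icc_of_mem_closure hm
  have h2 : z - m ∈ frontier (C.carrier : Set ℂ) := by
    rw [C.carrier.isOpen.frontier_eq]
    refine ⟨hm, fun h => ?_⟩
    have := C.re_mem h
    rw [Complex.sub_re, hre, Complex.intCast_re, zero_sub, mem_Ioo] at this
    have h3 : 0 < -m := by exact_mod_cast this.1
    have h4 : -m < 1 := by exact_mod_cast this.2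
    omega
  rw [Complex.sub_re, hre, Complex.intCast_re, zero_sub, mem_Icc] at h1
  have h3 : 0 ≤ -m := by exact_mod_cast h1.1
  have h4 : -m ≤ 1 := by exact_mod_cast h1.2
  obtain rfl | rfl : m = 0 ∨ m = -1 := by omega
  · have : z - (0 : ℤ) ∈ {0} ×ℂ Icc C.lower C.upper := by
      rw [← C.frontier_left]
      exact ⟨h2, by simp [hre]⟩
    simpa using (Complex.mem_reProdIm.1 this).2
  · have : z - (-1 : ℤ) ∈ {1} ×ℂ Icc C.lower C.upper := by
      rw [← C.frontier_right]
      exact ⟨h2, by simp [hre]⟩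
    simpa using (Complex.mem_reProdIm.1 this).2

/-- The corners of the cell do not belong to `Π`. -/
theorem im_mem_Ioo_of_re_eq_zero {z : ℂ} (hz : z ∈ C.domain) (hre : z.re = 0) :
    z.im ∈ Ioo C.lower C.upper := by
  have hcont : Continuous fun y : ℝ => Complex.I * (y : ℂ) := by fun_prop
  have h1 : (fun y : ℝ => Complex.I * (y : ℂ)) ⁻¹' (C.domain : Set ℂ) ⊆ Icc C.lower C.upper := by
    intro y hy
    simpa using C.im_mem_Icc_of_re_eq_zero hy (by simp)
  have h2 := interior_maximal h1 (C.domain.isOpen.preimage hcont)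
  rw [interior_Icc] at h2
  refine h2 (show Complex.I * (z.im : ℂ) ∈ (C.domain : Set ℂ) from ?_)
  rwa [show Complex.I * (z.im : ℂ) = z by apply Complex.ext <;> simp [hre]]

theorem mem_closure_of_mem_Icc {y : ℝ} (hy : y ∈ Icc C.lower C.upper) :
    Complex.I * y ∈ closure (C.carrier : Set ℂ) ∧
      1 + Complex.I * y ∈ closure (C.carrier : Set ℂ) := by
  constructor
  · have : Complex.I * (y : ℂ) ∈ frontier (C.carrier : Set ℂ) ∩ {z | z.re = 0} := by
      rw [C.frontier_left]
      exact Complex.mem_reProdIm.2 (by simpa using hy)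
    exact frontier_subset_closure this.1
  · have : 1 + Complex.I * (y : ℂ) ∈ frontier (C.carrier : Set ℂ) ∩ {z | z.re = 1} := by
      rw [C.frontier_right]
      exact Complex.mem_reProdIm.2 (by simpa using hy)
    exact frontier_subset_closure this.1

/-- The extension by quasiperiodicity of a function given in the strip `0 ≤ Re z < 1`. -/
def quasiperiodicExtend (η : ℝ) (g : ℂ → ℂ) (z : ℂ) : ℂ :=
  Complex.exp (Complex.I * η * ⌊z.re⌋) * g (z - ⌊z.re⌋)

theorem quasiperiodicExtend_add_one (η : ℝ) (g : ℂ → ℂ) (z : ℂ) :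
    quasiperiodicExtend η g (z + 1) = Complex.exp (Complex.I * η) * quasiperiodicExtend η g z := by
  have h : ⌊(z + 1).re⌋ = ⌊z.re⌋ + 1 := by simp
  rw [quasiperiodicExtend, quasiperiodicExtend, h, ← mul_assoc, ← Complex.exp_add]
  push_cast
  rw [add_sub_add_right_eq_sub]
  ring_nf

/-- At an interface point the two one-sided definitions of the extension are holomorphic and agree
on a vertical segment, so the identity theorem shows that they agree nearby. -/
theorem differentiableAt_quasiperiodicExtend_of_re_eq_zero {η : ℝ} {U : Set ℂ} {g : ℂ → ℂ}
    (hU : IsOpen U) (hCU : closure (C.carrier : Set ℂ) ∩ C.domain ⊆ U)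
    (hg : DifferentiableOn ℂ g U)
    (hq : ∀ y ∈ Ioo C.lower C.upper,
      g (1 + Complex.I * y) = Complex.exp (Complex.I * η) * g (Complex.I * y))
    {z : ℂ} (hz : z ∈ C.domain) (hre : z.re = 0) :
    DifferentiableAt ℂ (quasiperiodicExtend η g) z := by
  have hy := C.im_mem_Ioo_of_re_eq_zero hz hre
  have hzI : Complex.I * (z.im : ℂ) = z := by apply Complex.ext <;> simp [hre]
  obtain ⟨hc0, hc1⟩ := C.mem_closure_of_mem_Icc (Ioo_subset_Icc_self hy)
  rw [hzI] at hc0 hc1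
  have hzU : z ∈ U := hCU ⟨hc0, hz⟩
  have hz1U : z + 1 ∈ U := hCU ⟨by rwa [add_comm], C.add_one_mem_domain_iff.2 hz⟩
  have hA0 : AnalyticAt ℂ g z := hg.analyticAt (hU.mem_nhds hzU)
  have hA1 : AnalyticAt ℂ (fun w => Complex.exp (-(Complex.I * η)) * g (w + 1)) z := by
    refine analyticAt_const.mul ?_
    exact AnalyticAt.fun_comp (hg.analyticAt (hU.mem_nhds hz1U)) (by fun_prop)
  have hfreq : ∃ᶠ w in 𝓝[≠] z, g w = Complex.exp (-(Complex.I * η)) * g (w + 1) := by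
    have ht : Tendsto (fun y : ℝ => Complex.I * (y : ℂ)) (𝓝[≠] z.im) (𝓝[≠] z) := by
      refine tendsto_nhdsWithin_iff.2 ⟨?_, ?_⟩
      · have : ContinuousAt (fun y : ℝ => Complex.I * (y : ℂ)) z.im := by fun_prop
        rw [ContinuousAt, hzI] at this
        exact this.mono_left nhdsWithin_le_nhds
      · filter_upwards [self_mem_nhdsWithin] with y hy' heq
        exact hy' (by simpa using congrArg Complex.im (heq : Complex.I * (y : ℂ) = z))
    refine ht.frequently (Eventually.frequently ?_)
    filter_upwards [nhdsWithin_le_nhds (Ioo_mem_nhds hy.1 hy.2)] with y hy'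
    rw [add_comm (Complex.I * (y : ℂ)), hq y hy', ← mul_assoc, ← Complex.exp_add]
    simp
  have heq := (hA0.frequently_eq_iff_eventually_eq hA1).1 hfreq
  refine hA0.differentiableAt.congr_of_eventuallyEq ?_
  have hlt : ∀ᶠ w : ℂ in 𝓝 z, w.re ∈ Ioo (-1 : ℝ) 1 :=
    Complex.continuous_re.continuousAt.eventually (Ioo_mem_nhds (by simp [hre]) (by simp [hre]))
  filter_upwards [heq, hlt] with w hw hw'
  rcases le_or_gt 0 w.re with h | h
  · have hfl : ⌊w.re⌋ = 0 := Int.floor_eq_zero_iff.2 ⟨h, hw'.2⟩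
    simp [quasiperiodicExtend, hfl]
  · have hfl : ⌊w.re⌋ = -1 := by
      rw [Int.floor_eq_iff]
      push_cast
      constructor <;> linarith [hw'.1]
    rw [hw, quasiperiodicExtend, hfl]
    push_cast
    rw [sub_neg_eq_add, mul_neg_one]

theorem quasiperiodicExtend_add_intCast (η : ℝ) (g : ℂ → ℂ) (z : ℂ) (m : ℤ) :
    quasiperiodicExtend η g (z + m)
      = Complex.exp (Complex.I * η * m) * quasiperiodicExtend η g z := by
  have h : ⌊(z + m).re⌋ = ⌊z.re⌋ + m := by simp
  rw [quasiperiodicExtend, quasiperiodicExtend, h, ← mul_assoc, ← Complex.exp_add]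
  push_cast
  rw [add_sub_add_right_eq_sub]
  ring_nf

theorem differentiableOn_quasiperiodicExtend {η : ℝ} {U : Set ℂ} {g : ℂ → ℂ}
    (hU : IsOpen U) (hCU : closure (C.carrier : Set ℂ) ∩ C.domain ⊆ U)
    (hg : DifferentiableOn ℂ g U)
    (hq : ∀ y ∈ Ioo C.lower C.upper,
      g (1 + Complex.I * y) = Complex.exp (Complex.I * η) * g (Complex.I * y)) :
    DifferentiableOn ℂ (quasiperiodicExtend η g) C.domain := by
  -- by quasiperiodicity it suffices to treat points with `0 ≤ Re z < 1`
  have key : ∀ z ∈ C.domain, ⌊z.re⌋ = 0 → DifferentiableAt ℂ (quasiperiodicExtend η g) z := by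
    intro z hz hfl
    rw [Int.floor_eq_zero_iff] at hfl
    rcases hfl.1.eq_or_lt with h0 | h0
    · exact C.differentiableAt_quasiperiodicExtend_of_re_eq_zero hU hCU hg hq hz h0.symm
    · have hzU : z ∈ U := by
        obtain ⟨m, hm⟩ := C.exists_of_mem_domain hz
        have h1 := C.re_mem_Icc_of_mem_closure hm
        rw [Complex.sub_re, Complex.intCast_re, mem_Icc] at h1
        have h2 : m < 1 := by
          have : (m : ℝ) < 1 := by linarith [hfl.2]
          exact_mod_cast this
        have h3 : -1 < m := by
          have : (-1 : ℝ) < m := by linarith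
          exact_mod_cast this
        obtain rfl : m = 0 := by omega
        exact hCU ⟨by simpa using hm, hz⟩
      refine (hg.differentiableAt (hU.mem_nhds hzU)).congr_of_eventuallyEq ?_
      have hlt : ∀ᶠ w : ℂ in 𝓝 z, w.re ∈ Ioo (0 : ℝ) 1 :=
        Complex.continuous_re.continuousAt.eventually (Ioo_mem_nhds h0 hfl.2)
      filter_upwards [hlt] with w hw
      have : ⌊w.re⌋ = 0 := Int.floor_eq_zero_iff.2 ⟨hw.1.le, hw.2⟩
      simp [quasiperiodicExtend, this]
  intro z hz
  set n := ⌊z.re⌋ with hn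
  have h1 : z + ((-n : ℤ) : ℂ) ∈ C.domain := (C.add_intCast_mem_domain_iff (-n)).2 hz
  have h2 := key _ h1 (by
    rw [Complex.add_re, Complex.intCast_re, Int.floor_add_intCast, ← hn, add_neg_cancel])
  have h3 : quasiperiodicExtend η g = fun w => Complex.exp (Complex.I * η * n) *
      quasiperiodicExtend η g (w + ((-n : ℤ) : ℂ)) := by
    funext w
    rw [← quasiperiodicExtend_add_intCast]
    simp
  rw [h3]
  have h4 : DifferentiableAt ℂ (fun w => quasiperiodicExtend η g (w + ((-n : ℤ) : ℂ))) z :=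
    DifferentiableAt.comp z h2 (differentiableAt_id.add_const ((-n : ℤ) : ℂ))
  exact (h4.const_mul _).differentiableWithinAt

/-- Functions in `A²_{η,ext}(ϖ)` are exactly the square-integrable restrictions of quasiperiodic
holomorphic functions on the whole of `Π`. -/
theorem mem_quasiperiodicExt_iff {η : ℝ} {f : Lp ℂ 2 (volume.restrict (C.carrier : Set ℂ))} :
    f ∈ C.quasiperiodicExt η ↔ ∃ F : ℂ → ℂ, DifferentiableOn ℂ F C.domain ∧
      (∀ z, F (z + 1) = Complex.exp (Complex.I * η) * F z) ∧
      f =ᵐ[volume.restrict (C.carrier : Set ℂ)] F := by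
  constructor
  · rintro ⟨-, U, g, hU, hCU, -, hg, hfg, hq⟩
    refine ⟨quasiperiodicExtend η g, C.differentiableOn_quasiperiodicExtend hU hCU hg hq,
      quasiperiodicExtend_add_one η g, ?_⟩
    filter_upwards [hfg, ae_restrict_mem C.carrier.isOpen.measurableSet] with z h1 h2
    have h3 := C.re_mem h2
    have : ⌊z.re⌋ = 0 := Int.floor_eq_zero_iff.2 ⟨h3.1.le, h3.2⟩
    simp [quasiperiodicExtend, this, h1]
  · rintro ⟨F, hF, hq, hfF⟩
    refine ⟨⟨F, hF.mono C.carrier_subset_domain, hfF⟩, C.domain, F, C.domain.isOpen,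
      inter_subset_right, Subset.rfl, hF, hfF, fun y _ => ?_⟩
    rw [add_comm, hq]

/-! ### Multiplication by exponentials on the cell -/

theorem exists_norm_le : ∃ R : ℝ, 0 < R ∧ ∀ z ∈ C.carrier, ‖z‖ ≤ R := by
  obtain ⟨M, hM, h⟩ := C.subset_strip
  refine ⟨1 + M, by linarith, fun z hz => ?_⟩
  obtain ⟨h1, h2⟩ := Complex.mem_reProdIm.1 (h hz)
  refine (Complex.norm_le_abs_re_add_abs_im z).trans (add_le_add ?_ ?_)
  · rw [abs_of_pos h1.1]; exact h1.2.le
  · exact (abs_lt.2 h2).le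

theorem ae_carrier {p : ℂ → Prop} (h : ∀ z ∈ C.carrier, p z) :
    ∀ᵐ z ∂volume.restrict (C.carrier : Set ℂ), p z :=
  (ae_restrict_iff' C.carrier.isOpen.measurableSet).2 (Eventually.of_forall h)

theorem norm_exp_le_of_norm_le {η R : ℝ} {z : ℂ} (hz : ‖z‖ ≤ R) :
    ‖Complex.exp (Complex.I * η * z)‖ ≤ Real.exp (|η| * R) := by
  refine (Complex.norm_exp_le_exp_norm _).trans (Real.exp_le_exp.2 ?_)
  rw [norm_mul, norm_mul, Complex.norm_I, one_mul, Complex.norm_real, Real.norm_eq_abs]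
  gcongr

theorem memLp_exp (η : ℝ) : MemLp (fun z : ℂ => Complex.exp (Complex.I * η * z)) ∞
    (volume.restrict (C.carrier : Set ℂ)) := by
  obtain ⟨R, -, hR⟩ := C.exists_norm_le
  exact memLp_top_of_bound (by fun_prop) (Real.exp (|η| * R))
    (C.ae_carrier fun z hz => norm_exp_le_of_norm_le (hR z hz))

/-- Multiplication by `e^{i η z}` on `L²(ϖ)`. -/
def expMul (η : ℝ) : Lp ℂ 2 (volume.restrict (C.carrier : Set ℂ)) →L[ℂ]
    Lp ℂ 2 (volume.restrict (C.carrier : Set ℂ)) :=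
  mulOperator (C.memLp_exp η)

theorem coeFn_expMul (η : ℝ) (f : Lp ℂ 2 (volume.restrict (C.carrier : Set ℂ))) :
    C.expMul η f =ᵐ[volume.restrict (C.carrier : Set ℂ)]
      fun z => Complex.exp (Complex.I * η * z) * f z :=
  coeFn_mulOperator _ f

theorem expMul_expMul (η ζ : ℝ) (f : Lp ℂ 2 (volume.restrict (C.carrier : Set ℂ))) :
    C.expMul η (C.expMul ζ f) = C.expMul (η + ζ) f := by
  refine Lp.ext ?_
  filter_upwards [C.coeFn_expMul η (C.expMul ζ f), C.coeFn_expMul ζ f,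
    C.coeFn_expMul (η + ζ) f] with z h1 h2 h3
  rw [h1, h2, h3, ← mul_assoc, ← Complex.exp_add]
  push_cast
  ring_nf

theorem expMul_zero (f : Lp ℂ 2 (volume.restrict (C.carrier : Set ℂ))) : C.expMul 0 f = f := by
  refine Lp.ext ?_
  filter_upwards [C.coeFn_expMul 0 f] with z h1
  simp [h1]

theorem expMul_neg_expMul (η : ℝ) (f : Lp ℂ 2 (volume.restrict (C.carrier : Set ℂ))) :
    C.expMul (-η) (C.expMul η f) = f := by
  rw [expMul_expMul, neg_add_cancel, expMul_zero]

theorem expMul_expMul_neg (η : ℝ) (f : Lp ℂ 2 (volume.restrict (C.carrier : Set ℂ))) :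
    C.expMul η (C.expMul (-η) f) = f := by
  rw [expMul_expMul, add_neg_cancel, expMul_zero]

/-- The operators of multiplication by `e^{i η z}` depend norm-continuously on `η`, because the
cell is bounded. -/
theorem continuous_expMul : Continuous C.expMul := by
  obtain ⟨R, hR0, hR⟩ := C.exists_norm_le
  rw [continuous_iff_continuousAt]
  intro η₀
  rw [ContinuousAt, tendsto_iff_norm_sub_tendsto_zero]
  have hlim : Tendsto (fun η : ℝ => Real.exp (|η₀| * R) * (2 * (|η - η₀| * R))) (𝓝 η₀) (𝓝 0) := by
    have : ContinuousAt (fun η : ℝ => Real.exp (|η₀| * R) * (2 * (|η - η₀| * R))) η₀ := by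
      fun_prop
    simpa [ContinuousAt] using this
  have hsmall : ∀ᶠ η : ℝ in 𝓝 η₀, |η - η₀| * R < 1 := by
    have : ContinuousAt (fun η : ℝ => |η - η₀| * R) η₀ := by fun_prop
    exact this.eventually (gt_mem_nhds (by simp))
  refine squeeze_zero' (Eventually.of_forall fun _ => norm_nonneg _) ?_ hlim
  filter_upwards [hsmall] with η hη
  refine ContinuousLinearMap.opNorm_le_bound _ (by positivity) fun f => ?_
  refine Lp.norm_le_mul_norm_of_ae_le_mul ?_
  filter_upwards [C.coeFn_expMul η f, C.coeFn_expMul η₀ f,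
    Lp.coeFn_sub (C.expMul η f) (C.expMul η₀ f), C.ae_carrier hR] with z h1 h2 h3 h4
  have h5 : ((C.expMul η - C.expMul η₀) f) z = (Complex.exp (Complex.I * η₀ * z) *
      (Complex.exp (Complex.I * (η - η₀ : ℝ) * z) - 1)) * f z := by
    change (C.expMul η f - C.expMul η₀ f : Lp ℂ 2 (volume.restrict (C.carrier : Set ℂ))) z = _
    rw [h3, Pi.sub_apply, h1, h2, mul_sub, ← Complex.exp_add]
    push_cast
    ring_nf
  rw [h5, norm_mul, norm_mul]
  have h6 : ‖Complex.I * (η - η₀ : ℝ) * z‖ ≤ |η - η₀| * R := by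
    rw [norm_mul, norm_mul, Complex.norm_I, one_mul, Complex.norm_real, Real.norm_eq_abs]
    gcongr
  have h7 := (Complex.norm_exp_sub_one_le (h6.trans hη.le)).trans
    (mul_le_mul_of_nonneg_left h6 zero_le_two)
  gcongr
  exact norm_exp_le_of_norm_le h4

theorem expMul_mem_quasiperiodicExt (η : ℝ) {ζ : ℝ}
    {f : Lp ℂ 2 (volume.restrict (C.carrier : Set ℂ))} (hf : f ∈ C.quasiperiodicExt ζ) :
    C.expMul η f ∈ C.quasiperiodicExt (η + ζ) := by
  rw [mem_quasiperiodicExt_iff] at hf ⊢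
  obtain ⟨F, hF, hq, hfF⟩ := hf
  refine ⟨fun z => Complex.exp (Complex.I * η * z) * F z, ?_, fun z => ?_, ?_⟩
  · exact DifferentiableOn.mul (by fun_prop) hF
  · simp only [hq]
    rw [← mul_assoc, ← mul_assoc, ← Complex.exp_add, ← Complex.exp_add]
    push_cast
    ring_nf
  · filter_upwards [C.coeFn_expMul η f, hfF] with z h1 h2
    rw [h1, h2]

theorem expMul_mem_quasiperiodicSpace (η : ℝ) {ζ : ℝ}
    {f : Lp ℂ 2 (volume.restrict (C.carrier : Set ℂ))} (hf : f ∈ C.quasiperiodicSpace ζ) :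
    C.expMul η f ∈ C.quasiperiodicSpace (η + ζ) :=
  map_mem_closure (C.expMul η).continuous hf fun _ hg => C.expMul_mem_quasiperiodicExt η hg

/-! ### The cell operators as a continuous family on the space of periodic functions -/

/-- The embedding `v ↦ e^{i η z} v` of `A²_0(ϖ)` into `L²(ϖ)`, with range `A²_η(ϖ)`. -/
def fiberEmbed (η : ℝ) : C.quasiperiodicSpace 0 →L[ℂ]
    Lp ℂ 2 (volume.restrict (C.carrier : Set ℂ)) :=
  C.expMul η ∘L (C.quasiperiodicSpace 0).subtypeL

theorem continuous_fiberEmbed : Continuous C.fiberEmbed :=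
  C.continuous_expMul.clm_comp continuous_const

/-- In the coordinate `v ↦ e^{i η z} v` on `A²_η(ϖ)`, the cell operators act on a space that does
not depend on `η`. -/
theorem isUnit_cellToeplitz_iff {a : ℂ → ℂ}
    (ha : MemLp a ∞ (volume.restrict (C.domain : Set ℂ))) (c : ℂ) (η : ℝ) :
    IsUnit (C.cellToeplitz ha η - c • ContinuousLinearMap.id ℂ (C.quasiperiodicSpace η)) ↔
      IsUnit (formPullback (C.fiberEmbed η) (mulSubConst (C.memLp_carrier ha) c)) := by
  let N : C.quasiperiodicSpace 0 → C.quasiperiodicSpace η := fun v =>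
    ⟨C.expMul η v, by simpa using C.expMul_mem_quasiperiodicSpace η v.2⟩
  have hN : Function.Surjective N := fun w =>
    ⟨⟨C.expMul (-η) w, by simpa using C.expMul_mem_quasiperiodicSpace (-η) w.2⟩,
      Subtype.ext (C.expMul_expMul_neg η w)⟩
  refine isUnit_iff_of_pairing (N := N) (G := id) hN.denseRange denseRange_id
    one_ne_zero (C := ‖C.expMul η‖) (D := ‖C.expMul (-η)‖) (fun v => ?_) (fun v => ?_)
    fun u v => ?_
  · exact (C.expMul η).le_opNorm v
  · have := (C.expMul (-η)).le_opNorm (C.expMul η v)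
    rwa [C.expMul_neg_expMul] at this
  · rw [one_mul, cellToeplitz, inner_toeplitzOn]
    exact (inner_formPullback (C.fiberEmbed η) _ u v).symm

/-! ### Damping by a holomorphic weight -/

/-- A bound for `|Im z|` on the cell, chosen arbitrarily. -/
def imBound : ℝ := C.subset_strip.choose

theorem abs_im_le_imBound {z : ℂ} (hz : z ∈ C.domain) : |z.im| ≤ C.imBound := by
  obtain ⟨m, hm⟩ := C.exists_of_mem_domain hz
  have h1 : closure (C.carrier : Set ℂ) ⊆ {w : ℂ | |w.im| ≤ C.imBound} := by
    refine closure_minimal (fun w hw => ?_) (isClosed_le (by fun_prop) continuous_const)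
    exact (abs_lt.2 (Complex.mem_reProdIm.1 (C.subset_strip.choose_spec.2 hw)).2).le
  simpa using h1 hm

/-- The coordinate `ζ = c - i z`, with `c` so large that `Re ζ ≥ 1` in `Π`. -/
def zeta (z : ℂ) : ℂ := ((C.imBound + 1 : ℝ) : ℂ) - Complex.I * z

theorem zeta_re (z : ℂ) : (C.zeta z).re = C.imBound + 1 + z.im := by
  simp [zeta]

theorem zeta_im (z : ℂ) : (C.zeta z).im = -z.re := by
  simp [zeta]

theorem one_le_zeta_re {z : ℂ} (hz : z ∈ C.domain) : 1 ≤ (C.zeta z).re := by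
  rw [zeta_re]
  linarith [(abs_le.1 (C.abs_im_le_imBound hz)).1]

theorem zeta_ne_zero {z : ℂ} (hz : z ∈ C.domain) : C.zeta z ≠ 0 := fun h => by
  have := C.one_le_zeta_re hz
  rw [h, Complex.zero_re] at this
  linarith

theorem re_sq_add_one_le {z : ℂ} (hz : z ∈ C.domain) : z.re ^ 2 + 1 ≤ ‖C.zeta z‖ ^ 2 := by
  rw [← Complex.normSq_eq_norm_sq, Complex.normSq_apply, zeta_im]
  nlinarith [C.one_le_zeta_re hz]

theorem differentiable_zeta : Differentiable ℂ C.zeta := by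
  unfold zeta
  fun_prop

theorem norm_zeta_inv_le {z : ℂ} (hz : z ∈ C.domain) : ‖(C.zeta z)⁻¹‖ ≤ 1 := by
  rw [norm_inv]
  refine inv_le_one_of_one_le₀ ?_
  nlinarith [C.re_sq_add_one_le hz, norm_nonneg (C.zeta z), sq_nonneg z.re]

theorem ae_domain {p : ℂ → Prop} (h : ∀ z ∈ C.domain, p z) :
    ∀ᵐ z ∂volume.restrict (C.domain : Set ℂ), p z :=
  (ae_restrict_iff' C.domain.isOpen.measurableSet).2 (Eventually.of_forall h)

theorem memLp_zeta_inv :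
    MemLp (fun z => (C.zeta z)⁻¹) ∞ (volume.restrict (C.domain : Set ℂ)) :=
  memLp_top_of_bound C.differentiable_zeta.continuous.measurable.inv.aestronglyMeasurable 1
    (C.ae_domain fun _ hz => C.norm_zeta_inv_le hz)

theorem mulOperator_zeta_inv_mem {f : Lp ℂ 2 (volume.restrict (C.domain : Set ℂ))}
    (hf : f ∈ bergmanSpace C.domain) : mulOperator C.memLp_zeta_inv f ∈ bergmanSpace C.domain := by
  obtain ⟨g, hg, hfg⟩ := hf
  refine ⟨fun z => (C.zeta z)⁻¹ * g z, ?_, ?_⟩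
  · exact (C.differentiable_zeta.differentiableOn.inv fun z hz => C.zeta_ne_zero hz).mul hg
  · filter_upwards [coeFn_mulOperator C.memLp_zeta_inv f, hfg] with z h1 h2
    rw [h1, h2]

/-- Multiplication by `ζ⁻¹` on `A²(Π)`. -/
def damp : bergmanSpace C.domain →L[ℂ] bergmanSpace C.domain :=
  (mulOperator C.memLp_zeta_inv ∘L (bergmanSpace C.domain).subtypeL).codRestrict _
    fun f => C.mulOperator_zeta_inv_mem f.2

theorem coeFn_damp (f : bergmanSpace C.domain) :
    (C.damp f : Lp ℂ 2 (volume.restrict (C.domain : Set ℂ)))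
      =ᵐ[volume.restrict (C.domain : Set ℂ)]
        fun z => (C.zeta z)⁻¹ * (f : Lp ℂ 2 (volume.restrict (C.domain : Set ℂ))) z :=
  coeFn_mulOperator C.memLp_zeta_inv (f : Lp ℂ 2 (volume.restrict (C.domain : Set ℂ)))

/-- Since `Re ζ⁻¹ > 0`, no nonzero `f` is orthogonal to `ζ⁻¹ f`. -/
theorem denseRange_damp : DenseRange C.damp := by
  have h : (C.damp.range).topologicalClosure = ⊤ := by
    rw [Submodule.topologicalClosure_eq_top_iff, Submodule.eq_bot_iff]
    intro f hf
    have h0 : inner ℂ (C.damp f) f = 0 := hf _ ⟨f, rfl⟩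
    set F : Lp ℂ 2 (volume.restrict (C.domain : Set ℂ)) := f.1
    have h1 : ∫ z in (C.domain : Set ℂ),
        inner ℂ ((C.damp f : Lp ℂ 2 (volume.restrict (C.domain : Set ℂ))) z) (F z) = 0 := by
      rw [← L2.inner_def]
      exact h0
    have hint := L2.integrable_inner (𝕜 := ℂ)
      (C.damp f : Lp ℂ 2 (volume.restrict (C.domain : Set ℂ))) F
    have h2 := congrArg Complex.re h1
    rw [Complex.zero_re, ← RCLike.re_eq_complex_re, ← integral_re hint] at h2
    have hform : ∀ᵐ z ∂volume.restrict (C.domain : Set ℂ),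
        RCLike.re (inner ℂ ((C.damp f : Lp ℂ 2 (volume.restrict (C.domain : Set ℂ))) z) (F z))
          = (C.zeta z).re / ‖C.zeta z‖ ^ 2 * ‖F z‖ ^ 2 := by
      filter_upwards [C.coeFn_damp f] with z hz
      rw [hz, ← smul_eq_mul, inner_smul_left, inner_self_eq_norm_sq_to_K]
      have : ((RCLike.ofReal ‖F z‖ : ℂ)) ^ 2 = ((‖F z‖ ^ 2 : ℝ) : ℂ) := by norm_cast
      rw [this, RCLike.re_eq_complex_re, Complex.re_mul_ofReal, Complex.conj_re, Complex.inv_re,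
        Complex.normSq_eq_norm_sq]
    have hpos : ∀ z ∈ C.domain, 0 < (C.zeta z).re / ‖C.zeta z‖ ^ 2 := fun z hz =>
      div_pos (by linarith [C.one_le_zeta_re hz])
        (pow_pos (norm_pos_iff.2 (C.zeta_ne_zero hz)) 2)
    rw [integral_eq_zero_iff_of_nonneg_ae ?_ hint.re] at h2
    · refine Subtype.ext (Lp.ext ?_)
      filter_upwards [h2, hform, C.ae_domain hpos, Lp.coeFn_zero ℂ 2
        (volume.restrict (C.domain : Set ℂ))] with z e1 e2 e3 e4
      rw [e2] at e1
      have : ‖F z‖ ^ 2 = 0 := (mul_eq_zero.1 e1).resolve_left e3.ne'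
      have h5 : F z = 0 := by simpa using this
      exact h5.trans e4.symm
    · filter_upwards [hform, C.ae_domain hpos] with z e2 e3
      rw [e2]
      exact mul_nonneg e3.le (sq_nonneg _)
  have := Submodule.dense_iff_topologicalClosure_eq_top.2 h
  exact this

/-- Multiplication by `ζ⁻²` on `A²(Π)`. -/
def weightMul : bergmanSpace C.domain →L[ℂ] bergmanSpace C.domain := C.damp ∘L C.damp

theorem coeFn_weightMul (f : bergmanSpace C.domain) :
    (C.weightMul f : Lp ℂ 2 (volume.restrict (C.domain : Set ℂ)))
      =ᵐ[volume.restrict (C.domain : Set ℂ)] fun z => (C.zeta z ^ 2)⁻¹ *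
        (f : Lp ℂ 2 (volume.restrict (C.domain : Set ℂ))) z := by
  filter_upwards [C.coeFn_damp f, C.coeFn_damp (C.damp f)] with z h1 h2
  change (C.damp (C.damp f) : Lp ℂ 2 (volume.restrict (C.domain : Set ℂ))) z = _
  rw [h2, h1, ← mul_assoc, sq, mul_inv]

theorem denseRange_weightMul : DenseRange C.weightMul :=
  C.denseRange_damp.comp C.denseRange_damp C.damp.continuous

theorem inv_add_sq_le {x R : ℝ} (hx : |x| ≤ R) (m : ℤ) :
    ((x + m) ^ 2 + 1)⁻¹ ≤ (2 + 2 * R ^ 2) * ((m : ℝ) ^ 2 + 1)⁻¹ := by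
  rw [← div_eq_mul_inv, inv_eq_one_div, div_le_div_iff₀ (by positivity) (by positivity)]
  have : x ^ 2 ≤ R ^ 2 := sq_le_sq' (abs_le.1 hx).1 (abs_le.1 hx).2
  nlinarith [sq_nonneg (2 * x + m), sq_nonneg (R * (x + m))]

theorem summable_inv_sq_add_one : Summable fun m : ℤ => ((m : ℝ) ^ 2 + 1)⁻¹ := by
  have h := Real.summable_one_div_int_pow.2 (one_lt_two)
  refine Summable.of_norm_bounded_eventually h ?_
  filter_upwards [eventually_cofinite_ne (0 : ℤ)] with m hm
  have hm' : (0 : ℝ) < (m : ℝ) ^ 2 := by positivity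
  rw [Real.norm_of_nonneg (by positivity), one_div]
  exact inv_anti₀ hm' (by linarith)

theorem norm_weight_le {z : ℂ} (hz : z ∈ C.domain) {R : ℝ} (hR : |z.re| ≤ R) (m : ℤ) :
    ‖(C.zeta (z + m) ^ 2)⁻¹‖ ≤ (2 + 2 * R ^ 2) * ((m : ℝ) ^ 2 + 1)⁻¹ := by
  have h1 := C.re_sq_add_one_le ((C.add_intCast_mem_domain_iff m).2 hz)
  rw [Complex.add_re, Complex.intCast_re] at h1
  rw [norm_inv, norm_pow]
  exact (inv_anti₀ (by positivity) h1).trans (inv_add_sq_le hR m)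

theorem norm_cellRestrict_weightMul_le (m : ℤ) (f : bergmanSpace C.domain) :
    ‖C.cellRestrict m (C.weightMul f)‖ ≤ 4 * ((m : ℝ) ^ 2 + 1)⁻¹ * ‖f‖ := by
  refine le_trans ?_ (mul_le_mul_of_nonneg_left (C.norm_cellRestrict_le m f) (by positivity))
  refine Lp.norm_le_mul_norm_of_ae_le_mul ?_
  filter_upwards [C.coeFn_cellRestrict m (C.weightMul f), C.coeFn_cellRestrict m f,
    (C.quasiMeasurePreserving_translate m).ae (C.coeFn_weightMul f),
    ae_restrict_mem C.carrier.isOpen.measurableSet] with z h1 h2 h3 h4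
  have h5 := C.re_mem h4
  have h6 := C.norm_weight_le (C.carrier_subset_domain h4) (R := 1)
    (abs_le.2 ⟨by linarith [h5.1], h5.2.le⟩) m
  rw [h1, h3, h2, norm_mul]
  refine mul_le_mul_of_nonneg_right (h6.trans (le_of_eq ?_)) (norm_nonneg _)
  norm_num

/-! ### The Floquet transform -/

/-- The piece `(ζ⁻² f)(· + m)` of `ζ⁻² f` on the `m`-th cell. -/
def floquetTerm (m : ℤ) : bergmanSpace C.domain →ₗ[ℂ]
    Lp ℂ 2 (volume.restrict (C.carrier : Set ℂ)) :=
  (C.cellRestrict m ∘L (bergmanSpace C.domain).subtypeL ∘L C.weightMul).toLinearMap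

theorem summable_norm_floquetTerm (f : bergmanSpace C.domain) :
    Summable fun m => ‖C.floquetTerm m f‖ :=
  Summable.of_nonneg_of_le (fun _ => norm_nonneg _)
    (fun m => C.norm_cellRestrict_weightMul_le m f)
    ((summable_inv_sq_add_one.mul_left 4).mul_right _)

/-- The Floquet transform of `ζ⁻² f` at the quasimomentum `η`, as a function on the cell. -/
def floquet (η : ℝ) : bergmanSpace C.domain →ₗ[ℂ]
    Lp ℂ 2 (volume.restrict (C.carrier : Set ℂ)) :=
  fourierSum C.summable_norm_floquetTerm η

theorem coeFn_floquetTerm (m : ℤ) (f : bergmanSpace C.domain) {g : ℂ → ℂ}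
    (hg : f.1 =ᵐ[volume.restrict (C.domain : Set ℂ)] g) :
    C.floquetTerm m f =ᵐ[volume.restrict (C.carrier : Set ℂ)]
      fun z => (C.zeta (z + m) ^ 2)⁻¹ * g (z + m) := by
  filter_upwards [C.coeFn_cellRestrict m (C.weightMul f),
    (C.quasiMeasurePreserving_translate m).ae (C.coeFn_weightMul f),
    (C.quasiMeasurePreserving_translate m).ae hg] with z h1 h2 h3
  rw [← h3, ← h2]
  exact h1

theorem coeFn_floquet (η : ℝ) (f : bergmanSpace C.domain) {g : ℂ → ℂ}
    (hg : f.1 =ᵐ[volume.restrict (C.domain : Set ℂ)] g) :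
    C.floquet η f =ᵐ[volume.restrict (C.carrier : Set ℂ)]
      fun z => ∑' m : ℤ, phase η m * ((C.zeta (z + m) ^ 2)⁻¹ * g (z + m)) := by
  change ⇑(∑' m, phase η m • C.floquetTerm m f) =ᵐ[_] _
  have hsum : ∑' m, ‖phase η m • C.floquetTerm m f‖ₑ ≠ ∞ := by
    rw [tsum_enorm_ne_top_iff_summable_norm]
    simpa only [norm_phase_smul] using C.summable_norm_floquetTerm f
  filter_upwards [Lp.coeFn_tsum hsum, ae_all_iff.2 fun m => C.coeFn_floquetTerm m f hg,
    ae_all_iff.2 fun m => Lp.coeFn_smul (phase η m) (C.floquetTerm m f)] with z h1 h2 h3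
  rw [h1]
  refine tsum_congr fun m => ?_
  rw [h3, Pi.smul_apply, h2, smul_eq_mul]

/-- The defining series of the Floquet transform converges locally uniformly in all of `Π`, since
point evaluations are bounded by the `L²` norm. -/
theorem floquet_mem_quasiperiodicExt (η : ℝ) (f : bergmanSpace C.domain) :
    C.floquet η f ∈ C.quasiperiodicExt η := by
  obtain ⟨g, hg, hfg⟩ := f.2
  rw [mem_quasiperiodicExt_iff]
  refine ⟨_, fun z₀ hz₀ => ?_, fun z => ?_, C.coeFn_floquet η f hfg⟩
  · obtain ⟨r, hr, hball⟩ := Metric.isOpen_iff.1 C.domain.isOpen z₀ hz₀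
    obtain ⟨K, hK⟩ := bergman_pointwise_bound (R := r / 2) (by positivity)
    have hK0 : ∀ w ∈ Metric.ball z₀ (r / 2), ∀ m : ℤ, ‖g (w + m)‖ ≤ |K| * ‖f‖ := by
      intro w hw m
      refine (hK C.domain g (w + m) hg (fun x hx => ?_) f.1 hfg).trans
        (mul_le_mul_of_nonneg_right (le_abs_self K) (norm_nonneg f.1))
      rw [← sub_add_cancel x (m : ℂ)]
      refine (C.add_intCast_mem_domain_iff m).2 (hball ?_)
      rw [Metric.mem_closedBall, dist_eq_norm] at hx
      rw [Metric.mem_ball, dist_eq_norm] at hw ⊢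
      calc ‖x - m - z₀‖ = ‖(x - (w + m)) + (w - z₀)‖ := by ring_nf
        _ ≤ ‖x - (w + m)‖ + ‖w - z₀‖ := norm_add_le _ _
        _ < r := by linarith
    have hsub : Metric.ball z₀ (r / 2) ⊆ C.domain :=
      (Metric.ball_subset_ball (by linarith)).trans hball
    have hre : ∀ w ∈ Metric.ball z₀ (r / 2), |w.re| ≤ ‖z₀‖ + r / 2 := by
      intro w hw
      rw [Metric.mem_ball, dist_eq_norm] at hw
      have h1 := Complex.abs_re_le_norm w
      have h2 := norm_le_norm_add_norm_sub' w z₀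
      linarith
    have hd := Complex.differentiableOn_tsum_of_summable_norm (U := Metric.ball z₀ (r / 2))
      (F := fun (m : ℤ) z => phase η m * ((C.zeta (z + m) ^ 2)⁻¹ * g (z + m)))
      (u := fun m => ((2 + 2 * (‖z₀‖ + r / 2) ^ 2) * ((m : ℝ) ^ 2 + 1)⁻¹) * (|K| * ‖f‖))
      ((summable_inv_sq_add_one.mul_left _).mul_right _) (fun m => ?_) Metric.isOpen_ball
      (fun m w hw => ?_)
    · exact (hd.differentiableAt (Metric.ball_mem_nhds z₀ (by positivity))).differentiableWithinAt
    · have hmaps : MapsTo (fun z : ℂ => z + m) (Metric.ball z₀ (r / 2)) C.domain := fun w hw =>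
        (C.add_intCast_mem_domain_iff m).2 (hsub hw)
      have hadd : DifferentiableOn ℂ (fun z : ℂ => z + m) (Metric.ball z₀ (r / 2)) := by fun_prop
      have h1 : DifferentiableOn ℂ (fun z => (C.zeta z ^ 2)⁻¹ * g z) C.domain :=
        ((C.differentiable_zeta.pow 2).differentiableOn.inv fun z hz =>
          pow_ne_zero 2 (C.zeta_ne_zero hz)).mul hg
      exact (h1.comp hadd hmaps).const_mul _
    · rw [norm_mul, norm_mul, norm_phase, one_mul]
      exact mul_le_mul (C.norm_weight_le (hsub hw) (hre w hw) m) (hK0 w hw m) (norm_nonneg _)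
        (by positivity)
  · rw [← tsum_mul_left, ← (Equiv.subRight (1 : ℤ)).tsum_eq]
    refine tsum_congr fun m => ?_
    have h1 : phase η (m - 1) = Complex.exp (Complex.I * η) * phase η m := by
      rw [phase, phase, ← Complex.exp_add]
      push_cast
      ring_nf
    have h2 : z + 1 + ((m - 1 : ℤ) : ℂ) = z + m := by push_cast; ring
    rw [Equiv.subRight_apply, h2, h1, mul_assoc]

theorem expMul_neg_floquet_mem (η : ℝ) (f : bergmanSpace C.domain) :
    C.expMul (-η) (C.floquet η f) ∈ C.quasiperiodicSpace 0 := by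
  have := C.expMul_mem_quasiperiodicSpace (-η)
    (Submodule.le_topologicalClosure _ (C.floquet_mem_quasiperiodicExt η f))
  rwa [neg_add_cancel] at this

/-- The Floquet transform of `ζ⁻² f` at `η`, moved to the fixed space `A²_0(ϖ)`. -/
def fiberCoord (η : ℝ) : bergmanSpace C.domain →ₗ[ℂ] C.quasiperiodicSpace 0 :=
  ((C.expMul (-η)).toLinearMap ∘ₗ C.floquet η).codRestrict _ (C.expMul_neg_floquet_mem η)

theorem fiberEmbed_fiberCoord (η : ℝ) (f : bergmanSpace C.domain) :
    C.fiberEmbed η (C.fiberCoord η f) = C.floquet η f :=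
  C.expMul_expMul_neg η (C.floquet η f)

theorem continuous_fiberCoord (f : bergmanSpace C.domain) :
    Continuous fun η => C.fiberCoord η f := by
  refine Continuous.subtype_mk ?_ _
  exact (C.continuous_expMul.comp continuous_neg).clm_apply
    (continuous_fourierSum C.summable_norm_floquetTerm f)

/-- As the symbol is periodic, the form of `T_a - c` is the sum over the cells of the form of one
and the same multiplication operator on `L²(ϖ)`. -/
theorem hasSum_inner_floquetTerm_mulSubConst {a : ℂ → ℂ}
    (ha : MemLp a ∞ (volume.restrict (C.domain : Set ℂ)))
    (hper : ∀ᵐ z ∂volume.restrict (C.domain : Set ℂ), a z = a (z + 1)) (c : ℂ)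
    (f g : bergmanSpace C.domain) :
    HasSum (fun m => inner ℂ (C.floquetTerm m g)
        (mulSubConst (C.memLp_carrier ha) c (C.floquetTerm m f)))
      (inner ℂ (C.weightMul g) ((bergmanToeplitz C.domain ha -
        c • ContinuousLinearMap.id ℂ (bergmanSpace C.domain)) (C.weightMul f))) := by
  have h := C.hasSum_inner_cellRestrict (C.weightMul g).1 (mulSubConst ha c (C.weightMul f).1)
  simp_rw [C.cellRestrict_mulSubConst ha hper] at h
  rw [bergmanToeplitz, inner_toeplitzOn]
  exact h

theorem exists_norm_le_mul_norm_fiberEmbed : ∃ E : ℝ, ∀ η ∈ Icc (-Real.pi) Real.pi, ∀ v,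
    ‖v‖ ≤ E * ‖C.fiberEmbed η v‖ := by
  obtain ⟨E, hE⟩ := (isCompact_Icc (a := -Real.pi) (b := Real.pi)).exists_bound_of_continuousOn
    C.continuous_expMul.continuousOn
  refine ⟨E, fun η hη v => ?_⟩
  have := (C.expMul (-η)).le_of_opNorm_le (hE (-η) ⟨by linarith [hη.2], by linarith [hη.1]⟩)
    (C.expMul η v.1)
  rwa [C.expMul_neg_expMul] at this

end PeriodicCell

/-! ### Fourier–Laplace transforms of test functions -/

/-- The Fourier–Laplace transform `(2π)⁻¹ ∫ χ(t) e^{i t z} dt` of a function on `[-π, π]`. -/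
def testTransform (χ : ℝ → ℝ) (z : ℂ) : ℂ :=
  (2 * Real.pi : ℂ)⁻¹ * ∫ t in (-Real.pi)..Real.pi, (χ t : ℂ) * Complex.exp (Complex.I * t * z)

theorem differentiable_testTransform {χ : ℝ → ℝ} (hχ : Continuous χ) :
    Differentiable ℂ (testTransform χ) := by
  intro z₀
  refine DifferentiableAt.const_mul ?_ _
  have hc : ∀ z : ℂ, Continuous fun t : ℝ => (χ t : ℂ) * Complex.exp (Complex.I * t * z) :=
    fun z => by fun_prop
  have hc' : ∀ z : ℂ, Continuous fun t : ℝ =>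
      (χ t : ℂ) * (Complex.exp (Complex.I * t * z) * (Complex.I * t)) := fun z => by fun_prop
  refine (intervalIntegral.hasDerivAt_integral_of_dominated_loc_of_deriv_le
    (F' := fun z t => (χ t : ℂ) * (Complex.exp (Complex.I * t * z) * (Complex.I * t)))
    (bound := fun t => |χ t| * (Real.exp (|t| * (‖z₀‖ + 1)) * |t|))
    (Metric.ball_mem_nhds z₀ one_pos) (Eventually.of_forall fun z => (hc z).aestronglyMeasurable)
    ((hc z₀).intervalIntegrable _ _) (hc' z₀).aestronglyMeasurable
    (Eventually.of_forall fun t _ z hz => ?_)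
    ((by fun_prop : Continuous fun t : ℝ => |χ t| * (Real.exp (|t| * (‖z₀‖ + 1)) * |t|)
      ).intervalIntegrable _ _)
    (Eventually.of_forall fun t _ z hz => ?_)).2.differentiableAt
  · have hz' : ‖z‖ ≤ ‖z₀‖ + 1 := by
      rw [Metric.mem_ball, dist_eq_norm] at hz
      linarith [norm_le_norm_add_norm_sub' z z₀]
    rw [norm_mul, norm_mul, norm_mul, Complex.norm_I, one_mul, Complex.norm_real, Complex.norm_real,
      Real.norm_eq_abs, Real.norm_eq_abs]
    gcongr
    exact PeriodicCell.norm_exp_le_of_norm_le hz'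
  · have h1 : HasDerivAt (fun z : ℂ => Complex.I * t * z) (Complex.I * t) z := by
      simpa using (hasDerivAt_id z).const_mul (Complex.I * (t : ℂ))
    exact h1.cexp.const_mul _

/-- Integration by parts, without boundary terms because `χ` vanishes at `±π`. -/
theorem mul_testTransform {χ : ℝ → ℝ} (hχ : ContDiff ℝ (⊤ : ℕ∞) χ)
    (hs : tsupport χ ⊆ Ioo (-Real.pi) Real.pi) (z : ℂ) :
    Complex.I * z * testTransform χ z = -testTransform (deriv χ) z := by
  have hzero : ∀ t ∉ Ioo (-Real.pi) Real.pi, χ t = 0 := fun t ht =>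
    image_eq_zero_of_notMem_tsupport fun h => ht (hs h)
  have hd : ∀ t ∈ uIcc (-Real.pi) Real.pi, HasDerivAt (fun t : ℝ => (χ t : ℂ))
      ((deriv χ t : ℝ) : ℂ) t :=
    fun t _ => ((hχ.differentiable (by simp)).differentiableAt.hasDerivAt).ofReal_comp
  have he : ∀ t ∈ uIcc (-Real.pi) Real.pi, HasDerivAt
      (fun t : ℝ => Complex.exp (Complex.I * t * z))
      (Complex.exp (Complex.I * t * z) * (Complex.I * z)) t := by
    intro t _
    have h1 : HasDerivAt (fun t : ℝ => Complex.I * (t : ℂ) * z) (Complex.I * 1 * z) t :=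
      ((hasDerivAt_id t).ofReal_comp.const_mul Complex.I).mul_const z
    rw [mul_one] at h1
    exact h1.cexp
  have hdc : Continuous (deriv χ) := hχ.continuous_deriv (by simp)
  have h := intervalIntegral.integral_mul_deriv_eq_deriv_mul hd he
    ((by fun_prop : Continuous fun t : ℝ => ((deriv χ t : ℝ) : ℂ)).intervalIntegrable _ _)
    ((by fun_prop : Continuous fun t : ℝ =>
      Complex.exp (Complex.I * t * z) * (Complex.I * z)).intervalIntegrable _ _)
  rw [hzero Real.pi (by simp), hzero (-Real.pi) (by simp)] at h
  simp_rw [← mul_assoc ((χ _ : ℝ) : ℂ)] at h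
  rw [intervalIntegral.integral_mul_const] at h
  simp only [Complex.ofReal_zero, zero_mul, sub_self, zero_sub] at h
  rw [testTransform, testTransform, ← mul_neg, ← h]
  ring

theorem exists_norm_testTransform_le (k : ℕ) (M : ℝ) {χ : ℝ → ℝ} (hχ : ContDiff ℝ (⊤ : ℕ∞) χ)
    (hs : tsupport χ ⊆ Ioo (-Real.pi) Real.pi) :
    ∃ c, ∀ z : ℂ, |z.im| ≤ M → ‖z‖ ^ k * ‖testTransform χ z‖ ≤ c := by
  induction k generalizing χ with
  | zero =>
    obtain ⟨c, hc⟩ := (isCompact_Icc (a := -Real.pi) (b := Real.pi)).exists_bound_of_continuousOn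
      hχ.continuous.continuousOn
    refine ⟨‖(2 * Real.pi : ℂ)⁻¹‖ * (|c| * Real.exp (Real.pi * M) * |Real.pi - -Real.pi|),
      fun z hz => ?_⟩
    rw [pow_zero, one_mul, testTransform, norm_mul]
    gcongr
    refine intervalIntegral.norm_integral_le_of_norm_le_const fun t ht => ?_
    rw [uIoc_of_le (by linarith [Real.pi_pos])] at ht
    have ht' : |t| ≤ Real.pi := abs_le.2 ⟨ht.1.le, ht.2⟩
    rw [norm_mul, Complex.norm_exp, Complex.norm_real]
    have h1 : (Complex.I * t * z).re = -(t * z.im) := by simp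
    rw [h1]
    refine mul_le_mul ((hc t (Ioc_subset_Icc_self ht)).trans (le_abs_self c))
      (Real.exp_le_exp.2 ?_) (Real.exp_pos _).le (abs_nonneg _)
    refine (neg_le_abs _).trans ?_
    rw [abs_mul]
    gcongr
  | succ k ih =>
    have hχ' : ContDiff ℝ (⊤ : ℕ∞) (deriv χ) := hχ.iterate_deriv 1
    obtain ⟨c, hc⟩ := ih hχ' (tsupport_deriv_subset.trans hs)
    refine ⟨c, fun z hz => ?_⟩
    have h := congrArg norm (mul_testTransform hχ hs z)
    rw [norm_neg, norm_mul, norm_mul, Complex.norm_I, one_mul] at h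
    rw [pow_succ, mul_assoc, h]
    exact hc z hz

/-- The numbers `testTransform χ (z + m)` are, up to the sign of `m`, the Fourier coefficients of
`t ↦ χ(t) e^{i t z}` on `[-π, π]`. -/
theorem hasSum_testTransform {χ : ℝ → ℝ} (hχ : Continuous χ)
    (hs : tsupport χ ⊆ Ioo (-Real.pi) Real.pi) (z : ℂ)
    (hsum : Summable fun m : ℤ => testTransform χ (z + m)) {η : ℝ}
    (hη : η ∈ Ioc (-Real.pi) Real.pi) :
    HasSum (fun m : ℤ => phase η m * testTransform χ (z + m))
      (χ η * Complex.exp (Complex.I * η * z)) := by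
  have hzero : ∀ t ∉ Ioo (-Real.pi) Real.pi, χ t = 0 := fun t ht =>
    image_eq_zero_of_notMem_tsupport fun h => ht (hs h)
  have hT : Fact (0 < 2 * Real.pi) := ⟨Real.two_pi_pos⟩
  have hend : -Real.pi + 2 * Real.pi = Real.pi := by ring
  set h : ℝ → ℂ := fun t => (χ t : ℂ) * Complex.exp (Complex.I * t * z) with hh
  have hcont : Continuous (AddCircle.liftIoc (2 * Real.pi) (-Real.pi) h) := by
    refine AddCircle.liftIoc_continuous ?_ (by fun_prop)
    rw [hend, hh]
    simp [hzero Real.pi (by simp), hzero (-Real.pi) (by simp)]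
  set g : C(AddCircle (2 * Real.pi), ℂ) := ⟨_, hcont⟩ with hg
  have hgapp : ∀ t ∈ Ioc (-Real.pi) Real.pi, g (t : AddCircle (2 * Real.pi)) = h t := by
    intro t ht
    change AddCircle.liftIoc (2 * Real.pi) (-Real.pi) h (t : AddCircle (2 * Real.pi)) = h t
    exact AddCircle.liftIoc_coe_apply (by rwa [hend])
  have hf : ∀ (n : ℤ) (t : ℝ), fourier n (t : AddCircle (2 * Real.pi)) = phase t (-n) := by
    intro n t
    rw [fourier_coe_apply, phase]
    congr 1
    have : (Real.pi : ℂ) ≠ 0 := by exact_mod_cast Real.pi_ne_zero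
    push_cast
    field_simp
  have hcoef : ∀ n : ℤ, fourierCoeff g n = testTransform χ (z + (-n : ℤ)) := by
    intro n
    rw [fourierCoeff_eq_intervalIntegral _ n (-Real.pi), hend, testTransform]
    have h1 : ∫ t in (-Real.pi)..Real.pi, fourier (-n) (t : AddCircle (2 * Real.pi)) • g t
        = ∫ t in (-Real.pi)..Real.pi, (χ t : ℂ) * Complex.exp (Complex.I * t * (z + (-n : ℤ))) := by
      refine intervalIntegral.integral_congr_ae (Eventually.of_forall fun t ht => ?_)
      rw [uIoc_of_le (by linarith [Real.pi_pos])] at ht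
      rw [hgapp t ht, hf, neg_neg, hh, smul_eq_mul, phase, mul_left_comm, ← Complex.exp_add]
      push_cast
      ring_nf
    rw [h1, Complex.real_smul]
    push_cast
    rw [one_div]
  have hs' : Summable (fourierCoeff g) := by
    have h2 : fourierCoeff g = (fun m : ℤ => testTransform χ (z + m)) ∘ (Equiv.neg ℤ) := by
      funext n
      rw [hcoef]
      rfl
    rw [h2]
    exact (Equiv.neg ℤ).summable_iff.2 hsum
  have hp := has_pointwise_sum_fourier_series_of_summable hs' (η : AddCircle (2 * Real.pi))
  rw [hgapp η hη] at hp
  rw [← (Equiv.neg ℤ).hasSum_iff]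
  convert! hp using 2 with n
  rw [hcoef, hf, smul_eq_mul, mul_comm]
  rfl

namespace PeriodicCell

variable (C : PeriodicCell)

/-! ### Density of the range of the Floquet transform -/

theorem dense_quasiperiodicExt :
    Dense {v : C.quasiperiodicSpace 0 | v.1 ∈ C.quasiperiodicExt 0} := by
  have h := denseRange_inclusion_iff (subset_closure (s :=
    (C.quasiperiodicExt 0 : Set (Lp ℂ 2 (volume.restrict (C.carrier : Set ℂ)))))) |>.2 Subset.rfl
  refine h.mono ?_
  rintro _ ⟨w, rfl⟩
  exact w.2

/-- The factor `ζ²` compensates the weight `ζ⁻²` in the Floquet transform; it does not spoil the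
decay of the Fourier–Laplace transform along `Π`. -/
theorem exists_norm_zeta_sq_mul_testTransform_le {χ : ℝ → ℝ} (hχ : ContDiff ℝ (⊤ : ℕ∞) χ)
    (hs : tsupport χ ⊆ Ioo (-Real.pi) Real.pi) :
    ∃ c, 0 ≤ c ∧ ∀ z ∈ C.domain, ‖testTransform χ z‖ ≤ c * (z.re ^ 2 + 1)⁻¹ ∧
      ‖C.zeta z ^ 2 * testTransform χ z‖ ≤ c * (z.re ^ 2 + 1)⁻¹ := by
  -- two powers of `z` make up for `ζ²`, two more give the decay
  obtain ⟨c₀, h0⟩ := exists_norm_testTransform_le 0 C.imBound hχ hs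
  obtain ⟨c₄, h4⟩ := exists_norm_testTransform_le 4 C.imBound hχ hs
  set L := |C.imBound + 1|
  have hbound : ∀ z ∈ C.domain, (‖z‖ ^ 4 + 1) * ‖testTransform χ z‖ ≤ |c₀| + |c₄| := by
    intro z hz
    have e0 := h0 z (C.abs_im_le_imBound hz)
    have e4 := h4 z (C.abs_im_le_imBound hz)
    rw [pow_zero, one_mul] at e0
    linarith [le_abs_self c₀, le_abs_self c₄]
  refine ⟨(4 * L ^ 2 + 4) * (|c₀| + |c₄|), by positivity, fun z hz => ?_⟩
  have hre : z.re ^ 2 ≤ ‖z‖ ^ 2 := by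
    rw [← Complex.normSq_eq_norm_sq, Complex.normSq_apply]
    nlinarith [sq_nonneg z.im]
  have hζ : ‖C.zeta z‖ ^ 2 ≤ 2 * L ^ 2 + 2 * ‖z‖ ^ 2 := by
    have h1 : ‖C.zeta z‖ ≤ L + ‖z‖ := by
      refine (norm_sub_le _ _).trans (le_of_eq ?_)
      rw [norm_mul, Complex.norm_I, one_mul, Complex.norm_real, Real.norm_eq_abs]
    nlinarith [norm_nonneg (C.zeta z), sq_nonneg (L - ‖z‖), abs_nonneg (C.imBound + 1),
      norm_nonneg z]
  have hb := hbound z hz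
  have hpoly : (‖z‖ ^ 2 + 1) ^ 2 ≤ 2 * (‖z‖ ^ 4 + 1) := by nlinarith [sq_nonneg (‖z‖ ^ 2 - 1)]
  have ht := norm_nonneg (testTransform χ z)
  constructor
  · rw [← div_eq_mul_inv, le_div_iff₀ (by positivity)]
    calc ‖testTransform χ z‖ * (z.re ^ 2 + 1) ≤ ‖testTransform χ z‖ * (‖z‖ ^ 2 + 1) ^ 2 := by
          gcongr
          nlinarith [sq_nonneg ‖z‖, sq_nonneg (‖z‖ ^ 2)]
      _ ≤ ‖testTransform χ z‖ * (2 * (‖z‖ ^ 4 + 1)) := by gcongr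
      _ = 2 * ((‖z‖ ^ 4 + 1) * ‖testTransform χ z‖) := by ring
      _ ≤ 2 * (|c₀| + |c₄|) := by gcongr
      _ ≤ _ := mul_le_mul_of_nonneg_right (by nlinarith [sq_nonneg L]) (by positivity)
  · rw [← div_eq_mul_inv, le_div_iff₀ (by positivity), norm_mul, norm_pow]
    calc ‖C.zeta z‖ ^ 2 * ‖testTransform χ z‖ * (z.re ^ 2 + 1)
        ≤ (2 * L ^ 2 + 2 * ‖z‖ ^ 2) * ‖testTransform χ z‖ * (‖z‖ ^ 2 + 1) := by gcongr
      _ ≤ ((2 * L ^ 2 + 2) * (‖z‖ ^ 2 + 1)) * ‖testTransform χ z‖ * (‖z‖ ^ 2 + 1) := by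
          gcongr
          nlinarith [mul_nonneg (sq_nonneg L) (sq_nonneg ‖z‖)]
      _ = (2 * L ^ 2 + 2) * ‖testTransform χ z‖ * (‖z‖ ^ 2 + 1) ^ 2 := by ring
      _ ≤ (2 * L ^ 2 + 2) * ‖testTransform χ z‖ * (2 * (‖z‖ ^ 4 + 1)) := by gcongr
      _ = (4 * L ^ 2 + 4) * ((‖z‖ ^ 4 + 1) * ‖testTransform χ z‖) := by ring
      _ ≤ (4 * L ^ 2 + 4) * (|c₀| + |c₄|) := by gcongr

/-- A product of a decaying and a periodic square-integrable function belongs to `L²(Π)`. -/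
theorem memLp_mul_periodic {h F : ℂ → ℂ} (hh : ContinuousOn h C.domain)
    (hF : ContinuousOn F C.domain) {c : ℝ} (hc : 0 ≤ c)
    (hdecay : ∀ z ∈ C.domain, ‖h z‖ ≤ c * (z.re ^ 2 + 1)⁻¹) (hper : ∀ (m : ℤ) z, F (z + m) = F z)
    (hF2 : MemLp F 2 (volume.restrict (C.carrier : Set ℂ))) :
    MemLp (fun z => h z * F z) 2 (volume.restrict (C.domain : Set ℂ)) := by
  have hmeas : AEStronglyMeasurable (fun z => h z * F z) (volume.restrict (C.domain : Set ℂ)) :=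
    (hh.mul hF).aestronglyMeasurable C.domain.isOpen.measurableSet
  rw [memLp_two_iff_integrable_sq_norm hmeas, C.restrict_domain]
  have hFint : Integrable (fun z => ‖F z‖ ^ 2) (volume.restrict (C.carrier : Set ℂ)) :=
    (memLp_two_iff_integrable_sq_norm hF2.1).1 hF2
  have hb : ∀ (m : ℤ), ∀ z ∈ C.carrier, ‖h (z + m) * F (z + m)‖ ^ 2
      ≤ (4 * c) ^ 2 * ((m : ℝ) ^ 2 + 1)⁻¹ * ‖F z‖ ^ 2 := by
    intro m z hz
    have h1 := hdecay (z + m) ((C.add_intCast_mem_domain_iff m).2 (C.carrier_subset_domain hz))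
    have hre := C.re_mem hz
    have h2 := inv_add_sq_le (R := 1) (abs_le.2 ⟨by linarith [hre.1], hre.2.le⟩) m
    rw [Complex.add_re, Complex.intCast_re] at h1
    set w := ((m : ℝ) ^ 2 + 1)⁻¹ with hw
    have hw0 : 0 ≤ w := by positivity
    have hw1 : w ≤ 1 := inv_le_one_of_one_le₀ (by nlinarith [sq_nonneg (m : ℝ)])
    have h3 : ‖h (z + m)‖ ≤ 4 * c * w := by
      refine h1.trans ?_
      nlinarith [mul_le_mul_of_nonneg_left h2 hc]
    rw [hper, norm_mul, mul_pow]
    gcongr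
    calc ‖h (z + m)‖ ^ 2 ≤ (4 * c * w) ^ 2 := pow_le_pow_left₀ (norm_nonneg _) h3 2
      _ = (4 * c) ^ 2 * (w * w) := by ring
      _ ≤ (4 * c) ^ 2 * (w * 1) := by gcongr
      _ = _ := by ring
  have hemb : ∀ m : ℤ, MeasurableEmbedding fun z : ℂ => z + m := fun m =>
    (MeasurableEquiv.addRight (m : ℂ)).measurableEmbedding
  have hint : ∀ m : ℤ, Integrable (fun z : ℂ => ‖h (z + m) * F (z + m)‖ ^ 2)
      (volume.restrict (C.carrier : Set ℂ)) := by
    intro m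
    refine (hFint.const_mul ((4 * c) ^ 2 * ((m : ℝ) ^ 2 + 1)⁻¹)).mono' ?_ ?_
    · exact ((hmeas.comp_quasiMeasurePreserving
        (C.quasiMeasurePreserving_translate m)).norm).pow 2
    · refine C.ae_carrier fun z hz => ?_
      rw [Real.norm_of_nonneg (by positivity)]
      exact hb m z hz
  refine integrableOn_iUnion_of_summable_integral_norm
    (fun m => ?_) ?_
  · exact ((C.measurePreserving_translate_cell m).integrable_comp_emb (hemb m)).1 (hint m)
  · refine Summable.of_nonneg_of_le (fun m => integral_nonneg fun z => norm_nonneg _) (fun m => ?_)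
      ((summable_inv_sq_add_one.mul_left ((4 * c) ^ 2)).mul_right
        (∫ z in (C.carrier : Set ℂ), ‖F z‖ ^ 2))
    rw [← (C.measurePreserving_translate_cell m).integral_comp (hemb m), ← integral_const_mul]
    refine integral_mono_ae (hint m).norm (hFint.const_mul _) (C.ae_carrier fun z hz => ?_)
    change ‖‖h (z + m) * F (z + m)‖ ^ 2‖ ≤ _
    rw [Real.norm_of_nonneg (by positivity)]
    exact hb m z hz

/-- If `s` is the Fourier–Laplace transform of a test function `χ` and `F` is the periodic extension
of `v`, then `s F` has the Floquet transform `η ↦ χ(η) e^{i η z} v`. Hence `f = ζ² s F` has the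
asserted property. -/
theorem exists_fiberCoord_eq {χ : ℝ → ℝ} (hχ : ContDiff ℝ (⊤ : ℕ∞) χ)
    (hs : tsupport χ ⊆ Ioo (-Real.pi) Real.pi) {v : C.quasiperiodicSpace 0}
    (hv : v.1 ∈ C.quasiperiodicExt 0) :
    ∃ f, ∀ᵐ η ∂volume.restrict (Icc (-Real.pi) Real.pi), C.fiberCoord η f = (χ η : ℂ) • v := by
  obtain ⟨F, hF, hq, hvF⟩ := C.mem_quasiperiodicExt_iff.1 hv
  have hper1 : Function.Periodic F 1 := fun z => by simpa using hq z
  have hper : ∀ (m : ℤ) z, F (z + m) = F z := fun m z => by simpa using hper1.int_mul m z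
  obtain ⟨c, hc0, hc⟩ := C.exists_norm_zeta_sq_mul_testTransform_le hχ hs
  have hds := differentiable_testTransform hχ.continuous
  have hdh : Differentiable ℂ fun z => C.zeta z ^ 2 * testTransform χ z :=
    (C.differentiable_zeta.pow 2).mul hds
  have hF2 : MemLp F 2 (volume.restrict (C.carrier : Set ℂ)) :=
    (memLp_congr_ae hvF).1 (Lp.memLp v.1)
  have hmem := C.memLp_mul_periodic hdh.continuous.continuousOn hF.continuousOn hc0
    (fun z hz => (hc z hz).2) hper hF2
  refine ⟨⟨hmem.toLp, _, hdh.differentiableOn.mul hF, hmem.coeFn_toLp⟩, ?_⟩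
  -- `hasSum_testTransform` is stated on the half-open interval `]-π, π]`
  filter_upwards [Ioc_ae_eq_Icc (μ := volume.restrict (Icc (-Real.pi) Real.pi)) |>.mem_iff,
    ae_restrict_mem measurableSet_Icc] with η hη1 hη2
  have hη : η ∈ Ioc (-Real.pi) Real.pi := hη1.2 hη2
  refine Subtype.ext (Lp.ext ?_)
  set f : bergmanSpace C.domain := ⟨hmem.toLp, _, hdh.differentiableOn.mul hF, hmem.coeFn_toLp⟩
  have h1 : (C.fiberCoord η f).1 = C.expMul (-η) (C.floquet η f) := rfl
  have h2 : ((χ η : ℂ) • v).1 = (χ η : ℂ) • v.1 := rfl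
  rw [h1, h2]
  filter_upwards [C.coeFn_expMul (-η) (C.floquet η f), C.coeFn_floquet η f hmem.coeFn_toLp,
    Lp.coeFn_smul (χ η : ℂ) v.1, hvF,
    ae_restrict_mem C.carrier.isOpen.measurableSet] with z e1 e2 e3 e4 e5
  have hz := C.carrier_subset_domain e5
  have hzm : ∀ m : ℤ, z + m ∈ C.domain := fun m => (C.add_intCast_mem_domain_iff m).2 hz
  have hsum : Summable fun m : ℤ => testTransform χ (z + m) := by
    refine Summable.of_norm_bounded
      ((summable_inv_sq_add_one.mul_left (2 + 2 * |z.re| ^ 2)).mul_left c) fun m => ?_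
    refine (hc _ (hzm m)).1.trans ?_
    rw [Complex.add_re, Complex.intCast_re]
    exact mul_le_mul_of_nonneg_left (inv_add_sq_le le_rfl m) hc0
  have h3 : ∀ m : ℤ, phase η m * ((C.zeta (z + m) ^ 2)⁻¹ *
      (C.zeta (z + m) ^ 2 * testTransform χ (z + m) * F (z + m)))
      = phase η m * testTransform χ (z + m) * F z := by
    intro m
    rw [hper, mul_assoc (C.zeta (z + m) ^ 2),
      inv_mul_cancel_left₀ (pow_ne_zero 2 (C.zeta_ne_zero (hzm m))), mul_assoc]
  rw [e1, e2, e3, Pi.smul_apply, smul_eq_mul, e4]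
  simp_rw [h3]
  rw [tsum_mul_right, (hasSum_testTransform hχ.continuous hs z hsum hη).tsum_eq]
  calc Complex.exp (Complex.I * (-η : ℝ) * z) * (χ η * Complex.exp (Complex.I * η * z) * F z)
      = χ η * F z * (Complex.exp (Complex.I * (-η : ℝ) * z) * Complex.exp (Complex.I * η * z)) := by
        ring
    _ = χ η * F z := by
        rw [← Complex.exp_add]
        push_cast
        ring_nf
        simp

/-- The Floquet decomposition of `T_a - c` into the operators `T_{a,η} - c`. -/
theorem isUnit_bergmanToeplitz_iff {a : ℂ → ℂ}
    (ha : MemLp a ∞ (volume.restrict (C.domain : Set ℂ)))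
    (hper : ∀ᵐ z ∂volume.restrict (C.domain : Set ℂ), a z = a (z + 1)) (c : ℂ) :
    IsUnit (bergmanToeplitz C.domain ha - c • ContinuousLinearMap.id ℂ (bergmanSpace C.domain)) ↔
      ∀ η ∈ Icc (-Real.pi) Real.pi,
        IsUnit (C.cellToeplitz ha η - c • ContinuousLinearMap.id ℂ (C.quasiperiodicSpace η)) := by
  obtain ⟨E, hE⟩ := C.exists_norm_le_mul_norm_fiberEmbed
  simp_rw [C.isUnit_cellToeplitz_iff ha c]
  exact isUnit_iff_forall_fiber C.continuous_fiberCoord C.continuous_fiberEmbed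
    C.summable_norm_floquetTerm C.fiberEmbed_fiberCoord C.denseRange_weightMul
    (denseRange_familyToLp C.continuous_fiberCoord C.dense_quasiperiodicExt
      fun v hv χ hχ hs => C.exists_fiberCoord_eq hχ hs hv)
    (fun f g => C.hasSum_inner_cellRestrict (C.weightMul g).1 (C.weightMul f).1) hE
    (C.hasSum_inner_floquetTerm_mulSubConst ha hper c)

end PeriodicCell

end

theorem theorem4p1 (C : PeriodicCell) (a : ℂ → ℂ)
    (ha : MemLp a ∞ (volume.restrict (C.domain : Set ℂ)))
    (hper : ∀ᵐ z ∂volume.restrict (C.domain : Set ℂ), a z = a (z + 1)) :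
    essentialSpectrum (bergmanToeplitz C.domain ha) =
        (⋃ η ∈ Icc (-Real.pi) Real.pi, spectrum ℂ (C.cellToeplitz ha η)) ∧
      spectrum ℂ (bergmanToeplitz C.domain ha) =
        essentialSpectrum (bergmanToeplitz C.domain ha) := by
  have h := C.essentialSpectrum_eq_spectrum ha hper
  refine ⟨h.trans ?_, h.symm⟩
  ext c
  rw [mem_spectrum_iff_not_isUnit_sub, C.isUnit_bergmanToeplitz_iff ha hper]
  simp only [mem_iUnion, mem_spectrum_iff_not_isUnit_sub, not_forall, exists_prop]
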